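/- **Setting.** Let $P$ be a set of $n$ points $p_1,\dots,p_n\in\mathbb{R}^d$ (the points may even coincide), with the Euclidean norm, and let $1\le \ell<n$. The *$\ell$-center clustering problem* for $P$ asks for $\ell$ points $u_1,\dots,u_\ell\in\mathbb{R}^d$ (centers) minimizing $\max_{i\le n}\min_{t\le\ell}\|p_i-u_t\|_2$. The *minimum-diameter $\ell$-clustering problem* asks for a partition of $P$ into $\ell$ nonempty clusters $P_1,\dots,P_\ell$ minimizing $\max_{a\le \ell}\max_{u,v\in P_a}\|u-v\|_2$. A feasible solution is a $c$-approximation if its value is at most $c$ times the optimal value. An algorithm for the first problem is *conservative* if it always returns centers belonging to the input point set. Algorithms are uniform programs of a randomized real RAM (exact real arithmetic, integer indices, fair coin tosses, unit cost per operation), which get $n,d,\ell,\epsilon$ and the coordinates of the points as input. **Theorem.** For every constant $\beta\ge 1$ the following holds. 1. There are a conservative randomized algorithm and a constant $C$, depending only on $\beta$, such that for all $n,d$, all $1\le\ell<n$, all $\epsilon\in(0,1/2)$ and all $p_1,\dots,p_n\in\mathbb{R}^d$, the algorithm always halts within $C\, n\log n\,(d+\ell)/\epsilon^2$ steps and returns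 $\ell$ points $p_{\sigma(1)},\dots,p_{\sigma(\ell)}$ with $\sigma$ injective, and with probability at least $1-n^{-\beta}$ these are a $(2+\epsilon)$-approximation to the $\ell$-center clustering problem for $P$ (with respect to arbitrary centers in $\mathbb{R}^d$). 2. There are a randomized algorithm and a constant $C$, depending only on $\beta$, such that for all such inputs the algorithm always halts within $C\, n\log n\,(d+\ell)/\epsilon^2$ steps and returns a partition of $P$ into $\ell$ nonempty clusters, and with probability at least $1-n^{-\beta}$ this partition is a $(2+\epsilon)$-approximation to the minimum-diameter $\ell$-clustering problem for $P$. -/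

import Mathlib

/-! ## A randomized real RAM

Programs act on finitely many one-dimensional arrays of natural numbers (for indices and counters)
and of real numbers, with indirect addressing, and may toss fair coins.  Every node of an evaluated
expression and every executed instruction costs one unit of time.  There is no rounding, no
multiplication of natural numbers, and no transfer between naturals and reals other than through
tests and branching; the only constants in a program are natural numbers. -/

namespace RealRAM

/-- Memory: `nat a i` and `real a i` are the `i`-th cells of the `a`-th integer array and of the
`a`-th real array; `used` is the number of coins tossed so far. -/
structure State where
  nat : ℕ → ℕ → ℕ
  real : ℕ → ℕ → ℝ
  used : ℕ

/-- Integer expressions; `sub` is truncated subtraction, `read a e` is cell number `e` of array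
`a`. -/
inductive NExpr where
  | lit (m : ℕ)
  | read (a : ℕ) (e : NExpr)
  | add (e f : NExpr)
  | sub (e f : NExpr)

def NExpr.eval (s : State) : NExpr → ℕ
  | .lit m => m
  | .read a e => s.nat a (e.eval s)
  | .add e f => e.eval s + f.eval s
  | .sub e f => e.eval s - f.eval s

def NExpr.cost : NExpr → ℕ
  | .lit _ => 1
  | .read _ e => e.cost + 1
  | .add e f => e.cost + f.cost + 1
  | .sub e f => e.cost + f.cost + 1

/-- Real expressions: exact real arithmetic (a division by zero returns zero). -/
inductive RExpr where
  | lit (m : ℕ)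
  | read (a : ℕ) (e : NExpr)
  | add (e f : RExpr)
  | sub (e f : RExpr)
  | mul (e f : RExpr)
  | div (e f : RExpr)

noncomputable def RExpr.eval (s : State) : RExpr → ℝ
  | .lit m => (m : ℝ)
  | .read a e => s.real a (e.eval s)
  | .add e f => e.eval s + f.eval s
  | .sub e f => e.eval s - f.eval s
  | .mul e f => e.eval s * f.eval s
  | .div e f => e.eval s / f.eval s

def RExpr.cost : RExpr → ℕ
  | .lit _ => 1
  | .read _ e => e.cost + 1
  | .add e f => e.cost + f.cost + 1
  | .sub e f => e.cost + f.cost + 1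
  | .mul e f => e.cost + f.cost + 1
  | .div e f => e.cost + f.cost + 1

/-- Tests: comparisons of integers, comparisons of reals, and negation. -/
inductive Test where
  | natLe (e f : NExpr)
  | realLe (e f : RExpr)
  | not (b : Test)

def Test.Holds (s : State) : Test → Prop
  | .natLe e f => e.eval s ≤ f.eval s
  | .realLe e f => e.eval s ≤ f.eval s
  | .not b => ¬ b.Holds s

def Test.cost : Test → ℕ
  | .natLe e f => e.cost + f.cost + 1
  | .realLe e f => e.cost + f.cost + 1
  | .not b => b.cost + 1

/-- Programs. `setNat a i e` is the assignment `a[i] := e`, and `toss a i` stores a random bit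
in `a[i]`. -/
inductive Program where
  | setNat (a : ℕ) (i e : NExpr)
  | setReal (a : ℕ) (i : NExpr) (e : RExpr)
  | toss (a : ℕ) (i : NExpr)
  | seq (P Q : Program)
  | ite (b : Test) (P Q : Program)
  | loop (b : Test) (P : Program)

def State.setNat (s : State) (a i m : ℕ) : State :=
  { s with nat := Function.update s.nat a (Function.update (s.nat a) i m) }

def State.setReal (s : State) (a i : ℕ) (x : ℝ) : State :=
  { s with real := Function.update s.real a (Function.update (s.real a) i x) }

/-- `Exec ω P s s' t`: with the outcomes `ω 0, ω 1, …` of the coins, the program `P` started in the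
state `s` halts in the state `s'` after exactly `t` units of time.  (`loop b P` is
"while `b` do `P`".) -/
inductive Exec (ω : ℕ → Bool) : Program → State → State → ℕ → Prop where
  | setNat (a : ℕ) (i e : NExpr) (s : State) :
      Exec ω (.setNat a i e) s (s.setNat a (i.eval s) (e.eval s)) (i.cost + e.cost + 1)
  | setReal (a : ℕ) (i : NExpr) (e : RExpr) (s : State) :
      Exec ω (.setReal a i e) s (s.setReal a (i.eval s) (e.eval s)) (i.cost + e.cost + 1)
  | toss (a : ℕ) (i : NExpr) (s : State) :
      Exec ω (.toss a i) s
        { s.setNat a (i.eval s) (ω s.used).toNat with used := s.used + 1 } (i.cost + 1)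
  | seq {P Q : Program} {s₁ s₂ s₃ : State} {t u : ℕ} :
      Exec ω P s₁ s₂ t → Exec ω Q s₂ s₃ u → Exec ω (.seq P Q) s₁ s₃ (t + u)
  | iteTrue {b : Test} {P Q : Program} {s s' : State} {t : ℕ} :
      b.Holds s → Exec ω P s s' t → Exec ω (.ite b P Q) s s' (b.cost + t + 1)
  | iteFalse {b : Test} {P Q : Program} {s s' : State} {t : ℕ} :
      ¬ b.Holds s → Exec ω Q s s' t → Exec ω (.ite b P Q) s s' (b.cost + t + 1)
  | loopStop {b : Test} {P : Program} {s : State} :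
      ¬ b.Holds s → Exec ω (.loop b P) s s (b.cost + 1)
  | loopStep {b : Test} {P : Program} {s₁ s₂ s₃ : State} {t u : ℕ} :
      b.Holds s₁ → Exec ω P s₁ s₂ t → Exec ω (.loop b P) s₂ s₃ u →
      Exec ω (.loop b P) s₁ s₃ (b.cost + t + u + 1)

/-- Given the coins, the final state and the running time are unique. -/
theorem Exec.unique {ω : ℕ → Bool} {P : Program} {s s₁ s₂ : State} {t₁ t₂ : ℕ}
    (h₁ : Exec ω P s s₁ t₁) (h₂ : Exec ω P s s₂ t₂) : s₁ = s₂ ∧ t₁ = t₂ := by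
  induction h₁ generalizing s₂ t₂ with
  | setNat => cases h₂; exact ⟨rfl, rfl⟩
  | setReal => cases h₂; exact ⟨rfl, rfl⟩
  | toss => cases h₂; exact ⟨rfl, rfl⟩
  | seq _ _ ih₁ ih₂ =>
    cases h₂ with
    | seq k₁ k₂ =>
      obtain ⟨rfl, rfl⟩ := ih₁ k₁
      obtain ⟨rfl, rfl⟩ := ih₂ k₂
      exact ⟨rfl, rfl⟩
  | iteTrue hb _ ih =>
    cases h₂ with
    | iteTrue _ k => obtain ⟨rfl, rfl⟩ := ih k; exact ⟨rfl, rfl⟩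
    | iteFalse hb' _ => exact absurd hb hb'
  | iteFalse hb _ ih =>
    cases h₂ with
    | iteTrue hb' _ => exact absurd hb' hb
    | iteFalse _ k => obtain ⟨rfl, rfl⟩ := ih k; exact ⟨rfl, rfl⟩
  | loopStop hb =>
    cases h₂ with
    | loopStop _ => exact ⟨rfl, rfl⟩
    | loopStep hb' _ _ => exact absurd hb' hb
  | loopStep hb _ _ ih₁ ih₂ =>
    cases h₂ with
    | loopStop hb' => exact absurd hb hb'
    | loopStep _ k₁ k₂ =>
      obtain ⟨rfl, rfl⟩ := ih₁ k₁
      obtain ⟨rfl, rfl⟩ := ih₂ k₂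
      exact ⟨rfl, rfl⟩

/-- The distribution of an infinite sequence of independent fair coins. -/
noncomputable def coins : MeasureTheory.Measure (ℕ → Bool) :=
  MeasureTheory.Measure.infinitePi fun _ => (PMF.uniformOfFintype Bool).toMeasure

/-- The initial state for an instance: integer array `0` starts with `n, d, ℓ`, real array `0`
starts with `ε`, real array `1` holds the coordinates of the points row by row (coordinate `j` of
point `i` is in cell `i * d + j`), and all other cells are zero. -/
noncomputable def input {n d : ℕ} (ℓ : ℕ) (ε : ℝ) (p : Fin n → EuclideanSpace ℝ (Fin d)) :
    State where
  nat a i := if a = 0 then (if i = 0 then n else if i = 1 then d else if i = 2 then ℓ else 0) else 0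
  real a i :=
    if a = 0 then (if i = 0 then ε else 0)
    else if a = 1 then
      (if h : i < n * d then p (Fin.divNat ⟨i, h⟩) (Fin.modNat ⟨i, h⟩) else 0)
    else 0
  used := 0

/-- The `ℓ` points of `ℝᵈ` that are written row by row in real array `2`. -/
noncomputable def outputPoints (d ℓ : ℕ) (s : State) (t : Fin ℓ) : EuclideanSpace ℝ (Fin d) :=
  WithLp.toLp 2 fun j : Fin d => s.real 2 ((t : ℕ) * d + j)

/-- The assignment of the `n` points to `ℓ` clusters that is written in integer array `1`. -/
def OutputsClusters {n ℓ : ℕ} (s : State) (c : Fin n → Fin ℓ) : Prop :=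
  ∀ i : Fin n, s.nat 1 i = c i

end RealRAM

/-! ## The two clustering problems -/

namespace Clustering

variable {n d ℓ : ℕ}

/-- The maximal distance of an input point to its nearest center. -/
noncomputable def radius (p : Fin n → EuclideanSpace ℝ (Fin d))
    (T : Fin ℓ → EuclideanSpace ℝ (Fin d)) : ℝ :=
  ⨆ i : Fin n, ⨅ t : Fin ℓ, dist (p i) (T t)

/-- The optimal value of the `ℓ`-center problem; the centers are arbitrary points of `ℝᵈ`. -/
noncomputable def optRadius (ℓ : ℕ) (p : Fin n → EuclideanSpace ℝ (Fin d)) : ℝ :=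
  ⨅ T : Fin ℓ → EuclideanSpace ℝ (Fin d), radius p T

/-- The maximal diameter of the clusters `{p i | c i = a}`. -/
noncomputable def maxDiam (p : Fin n → EuclideanSpace ℝ (Fin d)) (c : Fin n → Fin ℓ) : ℝ :=
  ⨆ a : Fin ℓ, Metric.diam (p '' {i | c i = a})

/-- The optimal value of the minimum-diameter `ℓ`-clustering problem, over the partitions into `ℓ`
nonempty clusters. -/
noncomputable def optDiam (ℓ : ℕ) (p : Fin n → EuclideanSpace ℝ (Fin d)) : ℝ :=
  ⨅ c : {c : Fin n → Fin ℓ // Function.Surjective c}, maxDiam p c.1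

end Clustering

/-! ### Random sign projections: a Johnson–Lindenstrauss estimate. -/

namespace JL

open MeasureTheory ProbabilityTheory

/-! The algorithm is the farthest-point heuristic, run on a random projection of the points.

The heuristic yields ℓ centers such that the distance from any point q to its own center is at most
the distance between any two centers and at most the distance from q to any center. Hence q and the
ℓ centers form ℓ + 1 entries, and any labelling with ℓ labels repeats on two of them
(`IsFarthestPoint.exists_same_label`). For competing centers of radius r, label points by nearest
center: the repeated label gives two points within 2r, so q is within 2r of its center. For a
competing partition of diameter Δ, q is within Δ of its center, and two points with the same center
are within 2Δ.

The heuristic only compares distances, so distorted and unnormalized ones suffice. Each projected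
coordinate is a sum of the original ones with random signs. Such a sum is sub-Gaussian with the
right second moment, so a Chernoff bound for the sum of k squares (`tail_of_unit`) and a union bound
over pairs preserve all squared distances, up to the common factor k, within 1 ± ε/4. This fails
with probability at most n^(-β) when k is a large multiple of log n / ε². Comparisons then transfer
with a loss of 1 + ε/2 (`dist_le_of_projDist_le`), and 2(1 + ε/2) = 2 + ε.

Projecting costs O(k n d), and the heuristic computes O(n ℓ) distances in dimension k, so the time
is O(k n (d + ℓ)) whatever the coins are; only the quality is random. One program writes both
outputs. Its specification `ends_clusterProg` is proved in a small program logic that tracks running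
times. -/

theorem integral_exp_sq_gaussian {h : ℝ} (h1 : h < 1 / 2) :
    Integrable (fun g => Real.exp (h * g ^ 2)) (gaussianReal 0 1) ∧
    ∫ g, Real.exp (h * g ^ 2) ∂(gaussianReal 0 1) = 1 / √(1 - 2 * h) := by
  have key : ∀ x : ℝ, gaussianPDFReal 0 1 x * Real.exp (h * x ^ 2) =
      (√(2 * Real.pi))⁻¹ * Real.exp (-(1 / 2 - h) * x ^ 2) := by
    intro x
    simp only [gaussianPDFReal, NNReal.coe_one, mul_one, sub_zero]
    rw [mul_assoc, ← Real.exp_add]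
    congr 2
    ring
  constructor
  · rw [gaussianReal_of_var_ne_zero _ one_ne_zero]
    rw [integrable_withDensity_iff (measurable_gaussianPDF _ _)
      (ae_of_all _ fun x => gaussianPDF_lt_top)]
    simp only [toReal_gaussianPDF]
    have := (integrable_exp_neg_mul_sq (b := 1 / 2 - h) (by linarith)).const_mul (√(2 * Real.pi))⁻¹
    refine this.congr (ae_of_all _ fun x => ?_)
    simp only
    rw [← key]; ring
  · rw [integral_gaussianReal_eq_integral_smul one_ne_zero]
    simp only [smul_eq_mul, key]
    rw [integral_const_mul, integral_gaussian, ← Real.sqrt_inv, ← Real.sqrt_mul (by positivity),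
      one_div (√_), ← Real.sqrt_inv]
    congr 1
    have := Real.pi_ne_zero
    have h2 : 1 - 2 * h ≠ 0 := by linarith
    have h3 : 1 / 2 - h ≠ 0 := by linarith
    field_simp

/-- A sub-Gaussian variable with parameter one has an exponentially integrable square, with the
bound that a standard Gaussian attains. -/
theorem mgf_sq_le_of_subgaussian {Ω : Type*} [MeasurableSpace Ω] {μ : Measure Ω}
    [IsProbabilityMeasure μ] {X : Ω → ℝ} (hm : Measurable X) (hX : HasSubgaussianMGF X 1 μ)
    {h : ℝ} (h0 : 0 ≤ h) (h1 : h < 1 / 2) :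
    Integrable (fun ω => Real.exp (h * X ω ^ 2)) μ ∧
    mgf (fun ω => X ω ^ 2) μ h ≤ 1 / √(1 - 2 * h) := by
  -- Linearization of the square: exp(h x²) is the moment generating function of a standard Gaussian
  -- g at √(2h) x.
  have e1 : ∀ ω, ENNReal.ofReal (Real.exp (h * X ω ^ 2)) =
      ∫⁻ g, ENNReal.ofReal (Real.exp (√(2 * h) * X ω * g)) ∂(gaussianReal 0 1) := by
    intro ω
    rw [← ofReal_integral_eq_lintegral_ofReal (integrable_exp_mul_gaussianReal _)
      (ae_of_all _ fun _ => (Real.exp_pos _).le)]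
    have := mgf_gaussianReal (p := gaussianReal 0 1) (X := id) (μ := 0) (v := 1) (by simp)
      (√(2 * h) * X ω)
    simp only [mgf, id] at this
    rw [this, mul_pow, Real.sq_sqrt (by linarith)]
    congr 2
    push_cast
    ring
  have e2 : ∫⁻ ω, ENNReal.ofReal (Real.exp (h * X ω ^ 2)) ∂μ ≤
      ENNReal.ofReal (1 / √(1 - 2 * h)) := by
    -- After Tonelli, the sub-Gaussian bound for fixed g leaves the Gaussian integral of exp(h g²).
    simp_rw [e1]
    rw [lintegral_lintegral_swap (by fun_prop), ← (integral_exp_sq_gaussian h1).2,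
      ofReal_integral_eq_lintegral_ofReal (integral_exp_sq_gaussian h1).1
        (ae_of_all _ fun _ => (Real.exp_pos _).le)]
    refine lintegral_mono fun g => ?_
    have e3 : ∀ ω, √(2 * h) * X ω * g = √(2 * h) * g * X ω := fun ω => by ring
    simp_rw [e3]
    rw [← ofReal_integral_eq_lintegral_ofReal (hX.integrable_exp_mul _)
      (ae_of_all _ fun _ => (Real.exp_pos _).le)]
    refine ENNReal.ofReal_le_ofReal ((hX.mgf_le _).trans (le_of_eq ?_))
    rw [mul_pow, Real.sq_sqrt (by linarith)]
    congr 1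
    push_cast
    ring
  have hint : Integrable (fun ω => Real.exp (h * X ω ^ 2)) μ := by
    refine ⟨by fun_prop, ?_⟩
    rw [hasFiniteIntegral_iff_ofReal (ae_of_all _ fun _ => (Real.exp_pos _).le)]
    exact e2.trans_lt ENNReal.ofReal_lt_top
  refine ⟨hint, ?_⟩
  rw [← ofReal_integral_eq_lintegral_ofReal hint (ae_of_all _ fun _ => (Real.exp_pos _).le)] at e2
  exact (ENNReal.ofReal_le_ofReal_iff (by positivity)).1 e2

/-- The random sign given by a coin. -/
noncomputable def sign (b : Bool) : ℝ := if b then 1 else -1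

theorem sign_sq (b : Bool) : sign b ^ 2 = 1 := by cases b <;> simp [sign]

noncomputable abbrev coin : Measure Bool := (PMF.uniformOfFintype Bool).toMeasure

noncomputable abbrev coinRow (d : ℕ) : Measure (Fin d → Bool) := Measure.infinitePi fun _ => coin

noncomputable abbrev coinMatrix (k d : ℕ) : Measure (Fin k → Fin d → Bool) :=
  Measure.infinitePi fun _ => coinRow d

@[fun_prop]
theorem measurable_sign : Measurable sign := measurable_of_countable _

theorem integral_sign : ∫ b, sign b ∂coin = 0 := by
  rw [PMF.integral_eq_sum]
  simp [sign]

noncomputable def signSum {d : ℕ} (v : Fin d → ℝ) (r : Fin d → Bool) : ℝ := ∑ j, v j * sign (r j)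

@[fun_prop]
theorem measurable_signSum {d : ℕ} (v : Fin d → ℝ) : Measurable (signSum v) := by
  unfold signSum
  fun_prop

/-- Hoeffding's lemma on [-1, 1] gives the parameter ((1 - (-1)) / 2)² = 1, which is also the
variance. -/
theorem subgaussian_sign : HasSubgaussianMGF sign 1 coin := by
  have := hasSubgaussianMGF_of_mem_Icc_of_integral_eq_zero (μ := coin) (X := sign) (a := -1) (b := 1)
    measurable_sign.aemeasurable (ae_of_all _ fun b => by cases b <;> simp [sign]) integral_sign
  convert this using 1
  ext
  norm_num

theorem iIndepFun_sign (d : ℕ) : iIndepFun (fun (j : Fin d) (r : Fin d → Bool) => sign (r j))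
    (coinRow d) :=
  iIndepFun_infinitePi fun _ => measurable_sign

/-- Parameters of independent summands add up, here to the squared length of `v`. -/
theorem subgaussian_signSum {d : ℕ} (v : Fin d → ℝ) (hv : ∑ j, v j ^ 2 = 1) :
    HasSubgaussianMGF (signSum v) 1 (coinRow d) := by
  have h1 : ∀ j : Fin d, HasSubgaussianMGF (fun r : Fin d → Bool => v j * sign (r j))
      (‖v j‖₊ ^ 2) (coinRow d) := by
    intro j
    have : HasSubgaussianMGF (fun r : Fin d → Bool => sign (r j)) 1 (coinRow d) := by
      refine HasSubgaussianMGF.of_map (Y := fun r : Fin d → Bool => r j) (X := sign)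
        (Measurable.aemeasurable (by fun_prop)) ?_
      rw [Measure.infinitePi_map_eval]
      exact subgaussian_sign
    have h2 := this.const_mul (v j)
    refine ⟨h2.integrable_exp_mul, fun t => (h2.mgf_le t).trans_eq ?_⟩
    congr 3
    exact (mul_one (v j ^ 2)).trans (by simp)
  have h2 := HasSubgaussianMGF.sum_of_iIndepFun (s := Finset.univ)
    ((iIndepFun_sign d).comp (fun j x => v j * x) (fun j => by fun_prop)) (fun j _ => h1 j)
  have h3 : (1 : NNReal) = ∑ j : Fin d, ‖v j‖₊ ^ 2 := by
    ext
    push_cast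
    simp [hv]
  rw [h3]
  exact h2

theorem integral_signSum_sq {d : ℕ} (v : Fin d → ℝ) :
    ∫ r, signSum v r ^ 2 ∂(coinRow d) = ∑ j, v j ^ 2 := by
  have hb : ∀ i j : Fin d, Integrable (fun r : Fin d → Bool => v i * sign (r i) * (v j * sign (r j)))
      (coinRow d) := by
    intro i j
    refine Integrable.of_bound (C := |v i| * |v j|) (by fun_prop) (ae_of_all _ fun r => ?_)
    rcases r i <;> rcases r j <;> simp [sign]
  have h1 : ∀ i j : Fin d, ∫ r : Fin d → Bool, v i * sign (r i) * (v j * sign (r j)) ∂(coinRow d) =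
      if i = j then v i ^ 2 else 0 := by
    intro i j
    split_ifs with hij
    · subst hij
      have : ∀ r : Fin d → Bool, v i * sign (r i) * (v i * sign (r i)) = v i ^ 2 := by
        intro r
        rw [← sq, mul_pow, sign_sq, mul_one]
      simp [this]
    · have hz : ∀ l : Fin d, ∫ r : Fin d → Bool, sign (r l) ∂(coinRow d) = 0 := by
        intro l
        rw [← integral_sign, ← Measure.infinitePi_map_eval (fun _ : Fin d => coin) l,
          integral_map (Measurable.aemeasurable (by fun_prop)) (by fun_prop)]
      have h2 := ((iIndepFun_sign d).indepFun hij).integral_fun_mul_eq_mul_integral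
        (Measurable.aestronglyMeasurable (by fun_prop))
        (Measurable.aestronglyMeasurable (by fun_prop))
      have h3 : ∀ r : Fin d → Bool, v i * sign (r i) * (v j * sign (r j)) =
        v i * v j * (sign (r i) * sign (r j)) := fun r => by ring
      simp_rw [h3]
      rw [integral_const_mul, h2, hz]
      simp
  simp only [signSum, sq, Finset.sum_mul_sum]
  rw [integral_finsetSum _ fun i _ => integrable_finsetSum _ fun j _ => hb i j]
  refine Finset.sum_congr rfl fun i _ => ?_
  rw [integral_finsetSum _ fun j _ => hb i j]
  simp [h1, sq]
-- Since (1 + y + y²/2)(1 - y + y²/2) = 1 + y⁴/4 ≥ 1, the quadratic lower bound for exp y can be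
-- inverted.
theorem exp_neg_le_quadratic {y : ℝ} (hy : 0 ≤ y) : Real.exp (-y) ≤ 1 - y + y ^ 2 / 2 := by
  have h1 := Real.quadratic_le_exp_of_nonneg hy
  rw [Real.exp_neg, inv_le_iff_one_le_mul₀ (Real.exp_pos _)]
  have h2 : 0 ≤ 1 - y + y ^ 2 / 2 := by nlinarith [sq_nonneg (y - 1)]
  nlinarith [mul_le_mul_of_nonneg_left h1 h2, sq_nonneg (y ^ 2)]

theorem mgf_signSum_sq_le {d : ℕ} (v : Fin d → ℝ) (hv : ∑ j, v j ^ 2 = 1) {h : ℝ} (h0 : 0 ≤ h)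
    (h1 : h ≤ 1 / 6) :
    mgf (fun r => signSum v r ^ 2) (coinRow d) h ≤ Real.exp (h + 3 * h ^ 2) := by
  refine (mgf_sq_le_of_subgaussian (measurable_signSum v) (subgaussian_signSum v hv) h0
    (by linarith)).2.trans ?_
  have h2 : Real.exp (-(2 * h + 6 * h ^ 2)) ≤ 1 - 2 * h := by
    refine (exp_neg_le_quadratic (by positivity)).trans ?_
    nlinarith [mul_nonneg (sq_nonneg h) (sub_nonneg.2 h1),
      mul_nonneg (mul_nonneg (sq_nonneg h) h0) (sub_nonneg.2 h1)]
  have h3 : Real.exp (-(h + 3 * h ^ 2)) ≤ √(1 - 2 * h) := by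
    refine Real.le_sqrt_of_sq_le (le_trans (le_of_eq ?_) h2)
    rw [← Real.exp_nat_mul]
    congr 1
    push_cast
    ring
  rw [div_le_iff₀ (Real.sqrt_pos.2 (by linarith))]
  calc (1 : ℝ) = Real.exp (h + 3 * h ^ 2) * Real.exp (-(h + 3 * h ^ 2)) := by
        rw [← Real.exp_add]; simp
    _ ≤ _ := by gcongr

theorem integrable_of_coinRow {d : ℕ} (f : (Fin d → Bool) → ℝ) (hf : Measurable f) :
    Integrable f (coinRow d) := by
  obtain ⟨C, hC⟩ := (Set.finite_range fun r => ‖f r‖).bddAbove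
  exact Integrable.of_bound hf.aestronglyMeasurable C
    (ae_of_all _ fun r => hC (Set.mem_range_self r))

/-- The second-order term of exp(-hx) needs E x², which is controlled by an exponential moment:
(x/4)²/2 ≤ exp(x/4) - 1 - x/4. -/
theorem mgf_neg_signSum_sq_le {d : ℕ} (v : Fin d → ℝ) (hv : ∑ j, v j ^ 2 = 1) {h : ℝ}
    (h0 : 0 ≤ h) :
    mgf (fun r => signSum v r ^ 2) (coinRow d) (-h) ≤ Real.exp (-h + 3 * h ^ 2) := by
  have hX := mgf_sq_le_of_subgaussian (measurable_signSum v) (subgaussian_signSum v hv)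
    (h := 1 / 4) (by norm_num) (by norm_num)
  have hp : ∀ r, Real.exp (-h * signSum v r ^ 2) ≤
      1 - h * signSum v r ^ 2 +
        16 * h ^ 2 * (Real.exp (1 / 4 * signSum v r ^ 2) - 1 - 1 / 4 * signSum v r ^ 2) := by
    intro r
    set x := signSum v r ^ 2
    have hx : 0 ≤ x := sq_nonneg _
    have a1 := exp_neg_le_quadratic (mul_nonneg h0 hx)
    have a2 := Real.quadratic_le_exp_of_nonneg (x := 1 / 4 * x) (by positivity)
    rw [← neg_mul] at a1
    nlinarith [mul_le_mul_of_nonneg_left a2 (sq_nonneg h)]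
  -- The value √2 is rounded up to 23/16 because 16 (23/16 - 1 - 1/4) = 3, the same coefficient as
  -- in the upper tail.
  have hs : 1 / √(1 - 2 * (1 / 4)) ≤ (23 / 16 : ℝ) := by
    rw [div_le_iff₀ (Real.sqrt_pos.2 (by norm_num))]
    have : (16 / 23 : ℝ) ≤ √(1 - 2 * (1 / 4)) := Real.le_sqrt_of_sq_le (by norm_num)
    linarith
  have hE := hX.2.trans hs
  simp only [mgf] at hE ⊢
  calc _ ≤ ∫ r, (1 - h * signSum v r ^ 2 +
        16 * h ^ 2 * (Real.exp (1 / 4 * signSum v r ^ 2) - 1 - 1 / 4 * signSum v r ^ 2))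
          ∂(coinRow d) :=
        integral_mono (integrable_of_coinRow _ (by fun_prop))
          (integrable_of_coinRow _ (by fun_prop)) hp
    _ = 1 - h + 16 * h ^ 2 * ((∫ r, Real.exp (1 / 4 * signSum v r ^ 2) ∂(coinRow d)) - 1 - 1 / 4) := by
        rw [integral_add (integrable_of_coinRow _ (by fun_prop))
          (integrable_of_coinRow _ (by fun_prop)),
          integral_sub (integrable_of_coinRow _ (by fun_prop))
          (integrable_of_coinRow _ (by fun_prop)), integral_const_mul, integral_const_mul,
          integral_sub (integrable_of_coinRow _ (by fun_prop))
          (integrable_of_coinRow _ (by fun_prop)),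
          integral_sub (integrable_of_coinRow _ (by fun_prop))
          (integrable_of_coinRow _ (by fun_prop)), integral_const_mul, integral_signSum_sq, hv]
        simp
    _ ≤ 1 + (-h + 3 * h ^ 2) := by nlinarith [mul_le_mul_of_nonneg_left hE (sq_nonneg h)]
    _ ≤ _ := by linarith [Real.add_one_le_exp (-h + 3 * h ^ 2)]

theorem mgf_sum_signSum_sq {k d : ℕ} (v : Fin d → ℝ) (t : ℝ) :
    Integrable (fun R => Real.exp (t * ∑ l, signSum v (R l) ^ 2)) (coinMatrix k d) ∧
    mgf (fun R => ∑ l, signSum v (R l) ^ 2) (coinMatrix k d) t =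
      mgf (fun r => signSum v r ^ 2) (coinRow d) t ^ k := by
  have hi : iIndepFun (fun (l : Fin k) (R : Fin k → Fin d → Bool) => signSum v (R l) ^ 2)
      (coinMatrix k d) :=
    iIndepFun_infinitePi (P := fun _ : Fin k => coinRow d) (X := fun _ r => signSum v r ^ 2)
      fun _ => by fun_prop
  have hm : ∀ l : Fin k, (coinMatrix k d).map (fun R => R l) = coinRow d :=
    fun l => Measure.infinitePi_map_eval _ l
  have e : ∀ R : Fin k → Fin d → Bool, ∑ l, signSum v (R l) ^ 2 =
      (∑ l, fun R : Fin k → Fin d → Bool => signSum v (R l) ^ 2) R := fun R => by simp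
  constructor
  · simp_rw [e]
    refine hi.integrable_exp_mul_sum (fun l => by fun_prop) fun l _ => ?_
    have : Integrable (fun r => Real.exp (t * signSum v r ^ 2))
        ((coinMatrix k d).map fun R => R l) := by
      rw [hm]; exact integrable_of_coinRow _ (by fun_prop)
    exact this.comp_measurable (by fun_prop)
  · simp_rw [e]
    have := hi.mgf_sum (t := t) (fun l => by fun_prop) Finset.univ
    refine this.trans ?_
    have h2 : ∀ l : Fin k, mgf (fun R : Fin k → Fin d → Bool => signSum v (R l) ^ 2)
        (coinMatrix k d) t = mgf (fun r => signSum v r ^ 2) (coinRow d) t := by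
      intro l
      rw [← hm l, mgf_map (Measurable.aemeasurable (by fun_prop))
        (Measurable.aestronglyMeasurable (by fun_prop))]
      rfl
    simp [h2]

theorem tail_of_unit {k d : ℕ} (v : Fin d → ℝ) (hv : ∑ j, v j ^ 2 = 1) {δ : ℝ} (h0 : 0 ≤ δ)
    (h1 : δ ≤ 1) :
    (coinMatrix k d).real {R | (1 + δ) * k ≤ ∑ l, signSum v (R l) ^ 2} ≤
      Real.exp (-(k * δ ^ 2 / 12)) ∧
    (coinMatrix k d).real {R | ∑ l, signSum v (R l) ^ 2 ≤ (1 - δ) * k} ≤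
      Real.exp (-(k * δ ^ 2 / 12)) := by
  constructor
  -- The choice t = δ/6 minimizes -tδ + 3t², with value -δ²/12; δ ≤ 1 keeps t ≤ 1/6.
  · have h2 := measure_ge_le_exp_mul_mgf ((1 + δ) * k) (t := δ / 6) (by positivity)
      (mgf_sum_signSum_sq (k := k) v (δ / 6)).1
    refine h2.trans ?_
    rw [(mgf_sum_signSum_sq (k := k) v (δ / 6)).2]
    have h3 := mgf_signSum_sq_le v hv (h := δ / 6) (by positivity) (by linarith)
    calc _ ≤ Real.exp (-(δ / 6) * ((1 + δ) * k)) * Real.exp (δ / 6 + 3 * (δ / 6) ^ 2) ^ k := by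
          gcongr
          exact mgf_nonneg
      _ = _ := by
          rw [← Real.exp_nat_mul, ← Real.exp_add]
          congr 1
          ring
  · have h2 := measure_le_le_exp_mul_mgf ((1 - δ) * k) (t := -(δ / 6)) (by linarith)
      (mgf_sum_signSum_sq (k := k) v (-(δ / 6))).1
    refine h2.trans ?_
    rw [(mgf_sum_signSum_sq (k := k) v (-(δ / 6))).2]
    have h3 := mgf_neg_signSum_sq_le v hv (h := δ / 6) (by positivity)
    calc _ ≤ Real.exp (-(-(δ / 6)) * ((1 - δ) * k)) *
          Real.exp (-(δ / 6) + 3 * (δ / 6) ^ 2) ^ k := by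
          gcongr
          exact mgf_nonneg
      _ = _ := by
          rw [← Real.exp_nat_mul, ← Real.exp_add]
          congr 1
          ring

/-- The squared length of a vector is preserved up to a factor `1 ± δ`. -/
def Preserves (k : ℕ) {d : ℕ} (δ : ℝ) (v : Fin d → ℝ) (R : Fin k → Fin d → Bool) : Prop :=
  (1 - δ) * k * ∑ j, v j ^ 2 ≤ ∑ l, signSum v (R l) ^ 2 ∧
    ∑ l, signSum v (R l) ^ 2 ≤ (1 + δ) * k * ∑ j, v j ^ 2

theorem signSum_smul {d : ℕ} (c : ℝ) (v : Fin d → ℝ) (r : Fin d → Bool) :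
    signSum (fun j => c * v j) r = c * signSum v r := by
  simp [signSum, Finset.mul_sum, mul_assoc]

/-- By homogeneity a nonzero vector may be normalized; the zero vector is always preserved. -/
theorem measure_not_preserves_le {k d : ℕ} (v : Fin d → ℝ) {δ : ℝ} (h0 : 0 ≤ δ) (h1 : δ ≤ 1) :
    (coinMatrix k d).real {R | ¬ Preserves k δ v R} ≤ 2 * Real.exp (-(k * δ ^ 2 / 12)) := by
  by_cases hv : ∑ j, v j ^ 2 = 0
  · have hz : ∀ j, v j = 0 := fun j => by
      have := (Finset.sum_eq_zero_iff_of_nonneg fun j _ => sq_nonneg (v j)).1 hv j (Finset.mem_univ j)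
      exact pow_eq_zero_iff two_ne_zero |>.1 this
    have : {R : Fin k → Fin d → Bool | ¬ Preserves k δ v R} = ∅ := by
      ext R
      simp [Preserves, signSum, hz]
    rw [this]
    simp only [measureReal_empty]
    positivity
  · have hpos : 0 < ∑ j, v j ^ 2 := lt_of_le_of_ne (Finset.sum_nonneg fun j _ => sq_nonneg _) (Ne.symm hv)
    set N := ∑ j, v j ^ 2
    obtain ⟨b1, b2⟩ := tail_of_unit (k := k) (fun j => (√N)⁻¹ * v j) (by
      simp only [mul_pow, ← Finset.mul_sum, inv_pow, Real.sq_sqrt hpos.le]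
      exact inv_mul_cancel₀ hv) h0 h1
    simp only [signSum_smul, mul_pow, ← Finset.mul_sum, inv_pow, Real.sq_sqrt hpos.le] at b1 b2
    refine (measureReal_mono (fun R hR => ?_) (measure_ne_top _ _)).trans
      ((measureReal_union_le _ _).trans ((add_le_add b1 b2).trans_eq (by ring)))
    simp only [Preserves, Set.mem_ofPred_eq, not_and_or, not_le, Set.mem_union] at hR ⊢
    rcases hR with hR | hR
    · right
      rw [inv_mul_le_iff₀ hpos]
      linarith
    · left
      rw [le_inv_mul_iff₀ hpos]
      linarith
def coinRows (k d : ℕ) (ω : ℕ → Bool) (l : Fin k) (j : Fin d) : Bool := ω (l * d + j)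

theorem measurable_coinRows (k d : ℕ) : Measurable (coinRows k d) := by
  unfold coinRows
  fun_prop

/-- Distinct matrix entries use distinct coins, so the entries are again independent and fair. -/
theorem map_coinRows (k d : ℕ) : RealRAM.coins.map (coinRows k d) = coinMatrix k d := by
  have hinj : Function.Injective fun x : Fin k × Fin d => (x.1 : ℕ) * d + x.2 := by
    rintro ⟨l, j⟩ ⟨l', j'⟩ h
    have h2 : finProdFinEquiv (l, j) = finProdFinEquiv (l', j') := by
      ext
      simp only [finProdFinEquiv_apply_val]
      simp only at h
      rw [mul_comm d, mul_comm d]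
      omega
    exact finProdFinEquiv.injective h2
  have h1 := Measure.map_infinitePi_infinitePi_of_inj (P := fun _ : ℕ => coin) hinj
  have h2 := Measure.infinitePi_map_curry (ι := Fin k) (κ := Fin d) (X := Bool) (fun _ _ => coin)
  rw [← h1, Measure.map_map (by fun_prop) (by fun_prop)] at h2
  exact h2

instance : IsProbabilityMeasure RealRAM.coins := by
  unfold RealRAM.coins
  infer_instance

theorem one_sub_le_coins_preserves {n d : ℕ} (k : ℕ) (p : Fin n → EuclideanSpace ℝ (Fin d))
    {δ : ℝ} (h0 : 0 ≤ δ) (h1 : δ ≤ 1) :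
    1 - n ^ 2 * (2 * Real.exp (-(k * δ ^ 2 / 12))) ≤ RealRAM.coins.real
      {ω | ∀ a b, Preserves k δ (fun j => p a j - p b j) (coinRows k d ω)} := by
  set S := {R : Fin k → Fin d → Bool | ∀ a b, Preserves k δ (fun j => p a j - p b j) R} with hS
  have e1 : RealRAM.coins.real {ω | ∀ a b, Preserves k δ (fun j => p a j - p b j) (coinRows k d ω)} =
      (coinMatrix k d).real S := by
    rw [← map_coinRows, map_measureReal_apply (measurable_coinRows k d) S.toFinite.measurableSet]
    rfl
  have e2 : (coinMatrix k d).real Sᶜ ≤ n ^ 2 * (2 * Real.exp (-(k * δ ^ 2 / 12))) := by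
    have : Sᶜ ⊆ ⋃ x : Fin n × Fin n, {R | ¬ Preserves k δ (fun j => p x.1 j - p x.2 j) R} := by
      intro R hR
      simp only [hS, Set.mem_compl_iff, Set.mem_ofPred_eq, not_forall] at hR
      obtain ⟨a, b, hab⟩ := hR
      exact Set.mem_iUnion.2 ⟨(a, b), hab⟩
    refine (measureReal_mono this (measure_ne_top _ _)).trans
      ((measureReal_iUnion_fintype_le _).trans ?_)
    refine (Finset.sum_le_sum fun x _ => measure_not_preserves_le _ h0 h1).trans_eq ?_
    simp [sq]
  rw [e1]
  have := probReal_add_probReal_compl (μ := coinMatrix k d) S.toFinite.measurableSet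
  linarith

end JL

/-! ### The farthest-point heuristic under distorted distances. -/

namespace Clustering

open JL

/-- The centers `σ` and the assignment `c` could be the outcome of the farthest-point heuristic
for the squared distances `D`. -/
structure IsFarthestPoint {n ℓ : ℕ} (D : Fin n → Fin n → ℝ) (σ : Fin ℓ → Fin n)
    (c : Fin n → Fin ℓ) : Prop where
  assign_center : ∀ t, c (σ t) = t
  nearest : ∀ q t, D q (σ (c q)) ≤ D q (σ t)
  separated : ∀ q t u, t ≠ u → D q (σ (c q)) ≤ D (σ t) (σ u)

variable {n d ℓ : ℕ}

/-- Pigeonhole on the ℓ + 1 elements of `Option (Fin ℓ)`, with `none` standing for q. It remains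
valid when q is itself a center, since then `nearest` covers the pair. -/
theorem IsFarthestPoint.exists_same_label {D : Fin n → Fin n → ℝ} {σ : Fin ℓ → Fin n}
    {c : Fin n → Fin ℓ} (h : IsFarthestPoint D σ c) (hD : ∀ a b, D a b = D b a)
    (f : Fin n → Fin ℓ) (q : Fin n) : ∃ a b, f a = f b ∧ D q (σ (c q)) ≤ D a b := by
  let g : Option (Fin ℓ) → Fin n := fun o => o.elim q σ
  obtain ⟨x, y, hxy, he⟩ := Fintype.exists_ne_map_eq_of_card_lt (fun o => f (g o)) (by simp)
  refine ⟨g x, g y, he, ?_⟩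
  match x, y, hxy with
  | none, some t, _ => exact h.nearest q t
  | some t, none, _ => exact (h.nearest q t).trans_eq (hD _ _)
  | some t, some u, hxy => exact h.separated q t u (by simpa using hxy)

/-- Squared distances after the projection by a sign matrix. -/
noncomputable def projDist {k : ℕ} (p : Fin n → EuclideanSpace ℝ (Fin d))
    (R : Fin k → Fin d → Bool) (a b : Fin n) : ℝ :=
  ∑ l, signSum (fun j => p a j - p b j) (R l) ^ 2

theorem projDist_comm {k : ℕ} (p : Fin n → EuclideanSpace ℝ (Fin d))
    (R : Fin k → Fin d → Bool) (a b : Fin n) : projDist p R a b = projDist p R b a := by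
  unfold projDist
  refine Finset.sum_congr rfl fun l _ => ?_
  have : (fun j => p a j - p b j) = fun j => (-1) * (p b j - p a j) := by ext; ring
  rw [this, signSum_smul]
  ring

theorem dist_le_of_projDist_le {k : ℕ} {p : Fin n → EuclideanSpace ℝ (Fin d)}
    {R : Fin k → Fin d → Bool} {ε : ℝ} (h0 : 0 < ε) (h1 : ε < 1 / 2) (hk : 0 < k)
    (hR : ∀ a b, Preserves k (ε / 4) (fun j => p a j - p b j) R) {a b a' b' : Fin n}
    (h : projDist p R a b ≤ projDist p R a' b') :
    dist (p a) (p b) ≤ (1 + ε / 2) * dist (p a') (p b') := by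
  have e : ∀ a b, ∑ j, (p a j - p b j) ^ 2 = dist (p a) (p b) ^ 2 := by
    intro a b
    rw [EuclideanSpace.dist_eq, Real.sq_sqrt (Finset.sum_nonneg fun j _ => sq_nonneg _)]
    simp [Real.dist_eq, sq_abs]
  have h2 := ((hR a b).1.trans h).trans (hR a' b').2
  rw [e, e] at h2
  have hk' : (0 : ℝ) < k := by exact_mod_cast hk
  set x := dist (p a) (p b)
  set y := dist (p a') (p b')
  have hy : 0 ≤ y := dist_nonneg
  have h3 : (1 - ε / 4) * x ^ 2 ≤ (1 + ε / 4) * y ^ 2 := by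
    refine le_of_mul_le_mul_left ?_ hk'
    linarith
  refine abs_le_of_sq_le_sq' ?_ (by positivity) |>.2
  -- With x = ε/4 the right side is 1 + 3x - 4x³, which is at least 1 + x for small x.
  have h4 : (1 + ε / 4) ≤ (1 - ε / 4) * (1 + ε / 2) ^ 2 := by nlinarith [mul_pos h0 h0, mul_pos (mul_pos h0 h0) h0]
  refine le_of_mul_le_mul_left (h3.trans ?_) (by linarith : 0 < 1 - ε / 4)
  nlinarith [mul_le_mul_of_nonneg_right h4 (sq_nonneg y)]

theorem dist_le_two_mul_radius (p : Fin n → EuclideanSpace ℝ (Fin d)) (hℓ : 1 ≤ ℓ)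
    (T : Fin ℓ → EuclideanSpace ℝ (Fin d)) :
    ∃ f : Fin n → Fin ℓ, ∀ a b, f a = f b → dist (p a) (p b) ≤ 2 * radius p T := by
  have : Nonempty (Fin ℓ) := ⟨⟨0, hℓ⟩⟩
  have h1 : ∀ a, ∃ t, dist (p a) (T t) ≤ radius p T := by
    intro a
    obtain ⟨t, ht⟩ := exists_eq_ciInf_of_finite (f := fun t => dist (p a) (T t))
    refine ⟨t, ht.trans_le ?_⟩
    exact le_ciSup (f := fun i => ⨅ t, dist (p i) (T t)) (Set.finite_range _).bddAbove a
  choose f hf using h1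
  refine ⟨f, fun a b hab => ?_⟩
  have h2 := hf b
  rw [← hab] at h2
  linarith [dist_triangle_right (p a) (p b) (T (f a)), hf a]

theorem radius_le_of_farthestPoint {k : ℕ} {p : Fin n → EuclideanSpace ℝ (Fin d)}
    {R : Fin k → Fin d → Bool} {ε : ℝ} (h0 : 0 < ε) (h1 : ε < 1 / 2) (hk : 0 < k) (hℓ : 1 ≤ ℓ)
    (hn : ℓ < n) (hR : ∀ a b, Preserves k (ε / 4) (fun j => p a j - p b j) R)
    {σ : Fin ℓ → Fin n} {c : Fin n → Fin ℓ} (h : IsFarthestPoint (projDist p R) σ c) :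
    radius p (p ∘ σ) ≤ (2 + ε) * optRadius ℓ p := by
  have : Nonempty (Fin n) := ⟨⟨0, by omega⟩⟩
  refine ciSup_le fun q => ?_
  refine (ciInf_le (Set.finite_range _).bddBelow (c q)).trans ?_
  rw [← div_le_iff₀' (by linarith)]
  refine le_ciInf fun T => ?_
  rw [div_le_iff₀' (by linarith)]
  obtain ⟨f, hf⟩ := dist_le_two_mul_radius p hℓ T
  obtain ⟨a, b, hab, hd⟩ := h.exists_same_label (projDist_comm p R) f q
  have h2 := dist_le_of_projDist_le h0 h1 hk hR hd
  have h3 := mul_le_mul_of_nonneg_left (hf a b hab) (by linarith : 0 ≤ 1 + ε / 2)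
  simp only [Function.comp]
  linarith

theorem maxDiam_le_of_farthestPoint {k : ℕ} {p : Fin n → EuclideanSpace ℝ (Fin d)}
    {R : Fin k → Fin d → Bool} {ε : ℝ} (h0 : 0 < ε) (h1 : ε < 1 / 2) (hk : 0 < k) (hℓ : 1 ≤ ℓ)
    (hR : ∀ a b, Preserves k (ε / 4) (fun j => p a j - p b j) R)
    {σ : Fin ℓ → Fin n} {c : Fin n → Fin ℓ} (h : IsFarthestPoint (projDist p R) σ c) :
    maxDiam p c ≤ (2 + ε) * optDiam ℓ p := by
  have : Nonempty (Fin ℓ) := ⟨⟨0, hℓ⟩⟩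
  -- A real infimum over an empty type would be 0 by convention; the computed assignment itself
  -- shows that a partition exists.
  have : Nonempty {c : Fin n → Fin ℓ // Function.Surjective c} :=
    ⟨⟨c, fun t => ⟨σ t, h.assign_center t⟩⟩⟩
  rw [← div_le_iff₀' (by linarith)]
  refine le_ciInf fun f => ?_
  rw [div_le_iff₀' (by linarith)]
  have hM : ∀ a b, f.1 a = f.1 b → dist (p a) (p b) ≤ maxDiam p f.1 := by
    intro a b hab
    refine le_trans ?_ (le_ciSup (f := fun t => Metric.diam (p '' {i | f.1 i = t}))
      (Set.finite_range _).bddAbove (f.1 a))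
    exact Metric.dist_le_diam_of_mem (Set.toFinite _).isBounded ⟨a, rfl, rfl⟩ ⟨b, hab.symm, rfl⟩
  have hq : ∀ q, dist (p q) (p (σ (c q))) ≤ (1 + ε / 2) * maxDiam p f.1 := by
    intro q
    obtain ⟨a, b, hab, hd⟩ := h.exists_same_label (projDist_comm p R) f.1 q
    exact (dist_le_of_projDist_le h0 h1 hk hR hd).trans
      (mul_le_mul_of_nonneg_left (hM a b hab) (by linarith))
  have hnn : 0 ≤ maxDiam p f.1 := Real.iSup_nonneg fun _ => Metric.diam_nonneg
  refine ciSup_le fun t => Metric.diam_le_of_forall_dist_le (by positivity) ?_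
  rintro _ ⟨a, ha, rfl⟩ _ ⟨b, hb, rfl⟩
  have ha' : c a = t := ha
  have hb' : c b = t := hb
  have h2 := hq a
  have h3 := hq b
  rw [ha'] at h2
  rw [hb'] at h3
  linarith [dist_triangle_right (p a) (p b) (p (σ t))]

end Clustering

/-! ### A program logic with running times for the real RAM. -/

namespace RealRAM

/-- The program halts within `T` steps in a state that satisfies `Q`. -/
def Ends (ω : ℕ → Bool) (P : Program) (s : State) (T : ℕ) (Q : State → Prop) : Prop :=
  ∃ s' t, Exec ω P s s' t ∧ t ≤ T ∧ Q s'

attribute [simp] NExpr.eval NExpr.cost RExpr.eval RExpr.cost Test.Holds Test.cost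

/-- A syntactic overestimate of the modified arrays, computable so that side conditions on untouched
arrays are settled by `decide`. -/
def Program.natWrites : Program → List ℕ
  | .setNat a _ _ => [a]
  | .setReal _ _ _ => []
  | .toss a _ => [a]
  | .seq P Q => P.natWrites ++ Q.natWrites
  | .ite _ P Q => P.natWrites ++ Q.natWrites
  | .loop _ P => P.natWrites

def Program.realWrites : Program → List ℕ
  | .setNat _ _ _ => []
  | .setReal a _ _ => [a]
  | .toss _ _ => []
  | .seq P Q => P.realWrites ++ Q.realWrites
  | .ite _ P Q => P.realWrites ++ Q.realWrites
  | .loop _ P => P.realWrites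

def Program.tosses : Program → Bool
  | .setNat _ _ _ => false
  | .setReal _ _ _ => false
  | .toss _ _ => true
  | .seq P Q => P.tosses || Q.tosses
  | .ite _ P Q => P.tosses || Q.tosses
  | .loop _ P => P.tosses

/-- Arrays that `P` never writes to agree in `s` and `s'`. -/
structure Frame (P : Program) (s s' : State) : Prop where
  nat : ∀ {a}, a ∉ P.natWrites → s'.nat a = s.nat a
  real : ∀ {a}, a ∉ P.realWrites → s'.real a = s.real a
  used : P.tosses = false → s'.used = s.used

theorem Frame.refl (P : Program) (s : State) : Frame P s s := ⟨fun _ => rfl, fun _ => rfl, fun _ => rfl⟩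

theorem Frame.trans {P : Program} {s₁ s₂ s₃ : State} (h : Frame P s₁ s₂) (k : Frame P s₂ s₃) :
    Frame P s₁ s₃ :=
  ⟨fun ha => (k.nat ha).trans (h.nat ha), fun ha => (k.real ha).trans (h.real ha),
    fun ht => (k.used ht).trans (h.used ht)⟩

theorem Frame.mono {P Q : Program} {s s' : State} (h : Frame P s s')
    (hn : P.natWrites ⊆ Q.natWrites) (hr : P.realWrites ⊆ Q.realWrites)
    (ht : P.tosses = true → Q.tosses = true) : Frame Q s s' :=
  ⟨fun ha => h.nat fun k => ha (hn k), fun ha => h.real fun k => ha (hr k),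
    fun hQ => h.used (by cases hP : P.tosses <;> simp_all)⟩

theorem Frame.seq_left {P Q : Program} {s s' : State} (h : Frame P s s') :
    Frame (.seq P Q) s s' :=
  h.mono (by simp [Program.natWrites]) (by simp [Program.realWrites])
    (by simp +contextual [Program.tosses])

theorem Frame.seq_right {P Q : Program} {s s' : State} (h : Frame Q s s') :
    Frame (.seq P Q) s s' :=
  h.mono (by simp [Program.natWrites]) (by simp [Program.realWrites])
    (by simp +contextual [Program.tosses])

@[simp]
theorem State.nat_setNat (s : State) (a i m : ℕ) :
    (s.setNat a i m).nat a = Function.update (s.nat a) i m := by simp [State.setNat]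

@[simp]
theorem State.nat_setNat_of_ne (s : State) {a b : ℕ} (i m : ℕ) (h : b ≠ a) :
    (s.setNat a i m).nat b = s.nat b := by simp [State.setNat, h]

@[simp]
theorem State.real_setNat (s : State) (a i m : ℕ) : (s.setNat a i m).real = s.real := rfl

@[simp]
theorem State.used_setNat (s : State) (a i m : ℕ) : (s.setNat a i m).used = s.used := rfl

@[simp]
theorem State.real_setReal (s : State) (a i : ℕ) (x : ℝ) :
    (s.setReal a i x).real a = Function.update (s.real a) i x := by simp [State.setReal]

@[simp]
theorem State.real_setReal_of_ne (s : State) {a b : ℕ} (i : ℕ) (x : ℝ) (h : b ≠ a) :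
    (s.setReal a i x).real b = s.real b := by simp [State.setReal, h]

@[simp]
theorem State.nat_setReal (s : State) (a i : ℕ) (x : ℝ) : (s.setReal a i x).nat = s.nat := rfl

@[simp]
theorem State.used_setReal (s : State) (a i : ℕ) (x : ℝ) : (s.setReal a i x).used = s.used := rfl

/-- Specifications need to mention only what changes; everything else is recovered from this. -/
theorem Exec.frame {ω : ℕ → Bool} {P : Program} {s s' : State} {t : ℕ} (h : Exec ω P s s' t) :
    Frame P s s' := by
  induction h with
  | setNat a i e s =>
    refine ⟨fun {b} hb => ?_, fun _ => rfl, fun _ => rfl⟩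
    exact State.nat_setNat_of_ne _ _ _ (by simpa [Program.natWrites] using hb)
  | setReal a i e s =>
    refine ⟨fun _ => rfl, fun {b} hb => ?_, fun _ => rfl⟩
    exact State.real_setReal_of_ne _ _ _ (by simpa [Program.realWrites] using hb)
  | toss a i s =>
    refine ⟨fun {b} hb => ?_, fun _ => rfl, fun h => by simp [Program.tosses] at h⟩
    exact State.nat_setNat_of_ne _ _ _ (by simpa [Program.natWrites] using hb)
  | seq _ _ h k => exact h.seq_left.trans k.seq_right
  | iteTrue _ _ h =>
    exact h.mono (by simp [Program.natWrites]) (by simp [Program.realWrites])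
      (by simp +contextual [Program.tosses])
  | iteFalse _ _ h =>
    exact h.mono (by simp [Program.natWrites]) (by simp [Program.realWrites])
      (by simp +contextual [Program.tosses])
  | loopStop _ => exact Frame.refl _ _
  | loopStep _ _ _ h k =>
    exact Frame.trans (h.mono (by simp [Program.natWrites]) (by simp [Program.realWrites])
      (by simp +contextual [Program.tosses])) k

section Rules

variable {ω : ℕ → Bool} {P P' : Program} {s : State} {T T' : ℕ} {Q R : State → Prop}

theorem Ends.mono (h : Ends ω P s T Q) (hT : T ≤ T') (hQ : ∀ s', Frame P s s' → Q s' → R s') :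
    Ends ω P s T' R := by
  obtain ⟨s', t, he, ht, hq⟩ := h
  exact ⟨s', t, he, ht.trans hT, hQ s' he.frame hq⟩

theorem Ends.le (h : Ends ω P s T Q) (hT : T ≤ T') : Ends ω P s T' Q :=
  h.mono hT fun _ _ => id

theorem Ends.setNat {a : ℕ} {i e : NExpr} (h : Q (s.setNat a (i.eval s) (e.eval s))) :
    Ends ω (.setNat a i e) s (i.cost + e.cost + 1) Q :=
  ⟨_, _, .setNat a i e s, le_rfl, h⟩

theorem Ends.setReal {a : ℕ} {i : NExpr} {e : RExpr}
    (h : Q (s.setReal a (i.eval s) (e.eval s))) :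
    Ends ω (.setReal a i e) s (i.cost + e.cost + 1) Q :=
  ⟨_, _, .setReal a i e s, le_rfl, h⟩

theorem Ends.toss {a : ℕ} {i : NExpr}
    (h : Q { s.setNat a (i.eval s) (ω s.used).toNat with used := s.used + 1 }) :
    Ends ω (.toss a i) s (i.cost + 1) Q :=
  ⟨_, _, .toss a i s, le_rfl, h⟩

theorem Ends.seq (h : Ends ω P s T R) (k : ∀ s', Frame P s s' → R s' → Ends ω P' s' T' Q) :
    Ends ω (.seq P P') s (T + T') Q := by
  obtain ⟨s₁, t₁, he₁, ht₁, hr⟩ := h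
  obtain ⟨s₂, t₂, he₂, ht₂, hq⟩ := k s₁ he₁.frame hr
  exact ⟨s₂, _, .seq he₁ he₂, by omega, hq⟩

theorem Ends.setNat_seq {a : ℕ} {i e : NExpr}
    (h : Ends ω P (s.setNat a (i.eval s) (e.eval s)) T Q) :
    Ends ω (.seq (.setNat a i e) P) s (i.cost + e.cost + 1 + T) Q := by
  obtain ⟨s', t, he, ht, hq⟩ := h
  exact ⟨s', _, .seq (.setNat a i e s) he, by omega, hq⟩

theorem Ends.setReal_seq {a : ℕ} {i : NExpr} {e : RExpr}
    (h : Ends ω P (s.setReal a (i.eval s) (e.eval s)) T Q) :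
    Ends ω (.seq (.setReal a i e) P) s (i.cost + e.cost + 1 + T) Q := by
  obtain ⟨s', t, he, ht, hq⟩ := h
  exact ⟨s', _, .seq (.setReal a i e s) he, by omega, hq⟩

/-- Adding the costs of the branches instead of taking their maximum keeps all bounds polynomial. -/
theorem Ends.ite {b : Test} (h : b.Holds s → Ends ω P s T Q) (k : ¬ b.Holds s → Ends ω P' s T' Q) :
    Ends ω (.ite b P P') s (b.cost + (T + T') + 1) Q := by
  by_cases hb : b.Holds s
  · obtain ⟨s', t, he, ht, hq⟩ := h hb
    exact ⟨s', _, .iteTrue hb he, by omega, hq⟩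
  · obtain ⟨s', t, he, ht, hq⟩ := k hb
    exact ⟨s', _, .iteFalse hb he, by omega, hq⟩

/-- A loop that makes exactly `N` rounds, with an invariant that counts the rounds. -/
theorem Ends.loop {b : Test} {c : ℕ} (N : ℕ) (I : ℕ → State → Prop) (h₀ : I 0 s)
    (hstep : ∀ i < N, ∀ s', Frame (.loop b P) s s' → I i s' →
      b.Holds s' ∧ Ends ω P s' c (I (i + 1)))
    (hend : ∀ s', Frame (.loop b P) s s' → I N s' → ¬ b.Holds s') :
    Ends ω (.loop b P) s (N * (c + b.cost + 1) + b.cost + 1) (I N) := by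
  suffices H : ∀ m i, i + m = N → ∀ s', Frame (.loop b P) s s' → I i s' →
      Ends ω (.loop b P) s' (m * (c + b.cost + 1) + b.cost + 1) (I N) from
    H N 0 (by omega) s (Frame.refl _ _) h₀
  intro m
  induction m with
  | zero =>
    intro i hi s' hf hI
    obtain rfl : i = N := by omega
    exact ⟨s', _, .loopStop (hend s' hf hI), by omega, hI⟩
  | succ m ih =>
    intro i hi s' hf hI
    obtain ⟨hb, s₁, t₁, he₁, ht₁, hI₁⟩ := hstep i (by omega) s' hf hI
    have hf₁ : Frame (.loop b P) s s₁ := hf.trans (he₁.frame.mono (by simp [Program.natWrites])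
      (by simp [Program.realWrites]) (by simp +contextual [Program.tosses]))
    obtain ⟨s₂, t₂, he₂, ht₂, hI₂⟩ := ih (i + 1) (by omega) s₁ hf₁ hI₁
    refine ⟨s₂, _, .loopStep hb he₁ he₂, ?_, hI₂⟩
    rw [Nat.succ_mul]
    omega

end Rules

/-- The scalar variable stored in cell `0` of integer array `a`. -/
abbrev NExpr.var (a : ℕ) : NExpr := .read a (.lit 0)

/-- The scalar variable stored in cell `0` of real array `a`. -/
abbrev RExpr.var (a : ℕ) : RExpr := .read a (.lit 0)

/-- Assignment to a scalar variable. -/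
abbrev Program.assign (a : ℕ) (e : NExpr) : Program := .setNat a (.lit 0) e

abbrev Program.assignReal (a : ℕ) (e : RExpr) : Program := .setReal a (.lit 0) e

/-- "for `v` from `0` to `bound - 1` do `P`". -/
abbrev Program.forTo (v : ℕ) (bound : NExpr) (P : Program) : Program :=
  .seq (.assign v (.lit 0)) (.loop (.not (.natLe bound (.var v)))
    (.seq P (.assign v (.add (.var v) (.lit 1)))))

/-- The counter is tracked separately and handed to the body, so the invariant must be insensitive
to cell `v`. The 11 is 6 for the increment, 4 for the test beyond `bound.cost`, and 1 for the round.
-/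
theorem Ends.forTo {ω : ℕ → Bool} {P : Program} {s : State} {c v N : ℕ} {bound : NExpr}
    (I : ℕ → State → Prop) (hv : v ∉ P.natWrites) (h₀ : I 0 s)
    (hb : ∀ s', Frame (.forTo v bound P) s s' → bound.eval s' = N)
    (hI : ∀ i s' m, I i s' → I i (s'.setNat v 0 m))
    (hstep : ∀ i < N, ∀ s', Frame (.forTo v bound P) s s' → s'.nat v 0 = i → I i s' →
      Ends ω P s' c (I (i + 1))) :
    Ends ω (.forTo v bound P) s (N * (c + bound.cost + 11) + bound.cost + 8) (I N) := by
  have hv0 : (s.setNat v 0 0).nat v 0 = 0 := by simp [State.nat_setNat]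
  have hf0 : Frame (.forTo v bound P) s (s.setNat v 0 0) :=
    (Exec.setNat (ω := ω) v (.lit 0) (.lit 0) s).frame.seq_left
  refine Ends.le (Ends.setNat_seq (Ends.mono (Ends.loop (c := c + 6) N
    (fun i s' => s'.nat v 0 = i ∧ I i s') ⟨hv0, hI _ _ _ h₀⟩ ?_ ?_) le_rfl fun s' _ h => h.2)) ?_
  · rintro i hi s' hf ⟨hvi, hIi⟩
    have hf' := hf0.trans (Frame.seq_right (P := .assign v (.lit 0)) hf)
    refine ⟨?_, Ends.seq (T' := 6) (hstep i hi s' hf' hvi hIi) fun s₁ hf₁ hI₁ => ?_⟩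
    · simp only [Test.Holds, hb s' hf', NExpr.eval, hvi]
      omega
    · refine Ends.setNat ⟨?_, hI _ _ _ hI₁⟩
      simp [State.nat_setNat, NExpr.eval, hf₁.nat hv, hvi]
  · rintro s' hf ⟨hvi, -⟩
    have hf' := hf0.trans (Frame.seq_right (P := .assign v (.lit 0)) hf)
    simp [Test.Holds, hb s' hf', NExpr.eval, hvi]
  · simp only [NExpr.cost, Test.cost]
    have : c + 6 + (bound.cost + (1 + 1) + 1 + 1) + 1 = c + bound.cost + 11 := by ring
    rw [this]
    omega

/-! ### Programs for projected distances and for the projection. -/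

/-- Squared distance of the rows `a` and `b` of an array of `k` columns of length `n`. -/
def sqDist (y : ℕ → ℝ) (n k a b : ℕ) : ℝ :=
  ∑ l ∈ Finset.range k, (y (a + l * n) - y (b + l * n)) ^ 2

/-- `real 6 := ` squared distance of the projected points with indices `nat 11` and `nat 9`. -/
def distProg : Program :=
  .seq (.assign 13 (.var 11)) (.seq (.assign 14 (.var 9)) (.seq (.assignReal 6 (.lit 0))
    (.forTo 5 (.var 3) (.seq
      (.assignReal 6 (.add (.var 6) (.mul (.sub (.read 5 (.var 13)) (.read 5 (.var 14)))
        (.sub (.read 5 (.var 13)) (.read 5 (.var 14))))))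
      (.seq (.assign 13 (.add (.var 13) (.var 0))) (.assign 14 (.add (.var 14) (.var 0))))))))

/-- Consecutive coordinates of a projected point lie n cells apart, so both addresses advance by
adding n; indices cannot be multiplied. -/
theorem ends_distProg (ω : ℕ → Bool) (s : State) :
    Ends ω distProg s (47 * s.nat 3 0 + 30) fun s' =>
      s'.real 6 0 = sqDist (s.real 5) (s.nat 0 0) (s.nat 3 0) (s.nat 11 0) (s.nat 9 0) := by
  refine Ends.le (Ends.setNat_seq (Ends.setNat_seq (Ends.setReal_seq (Ends.mono
    (Ends.forTo (c := 34) (N := s.nat 3 0) (fun i s' =>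
      s'.nat 13 0 = s.nat 11 0 + i * s.nat 0 0 ∧ s'.nat 14 0 = s.nat 9 0 + i * s.nat 0 0 ∧
      s'.real 6 0 = sqDist (s.real 5) (s.nat 0 0) i (s.nat 11 0) (s.nat 9 0))
      (by decide) ?_ ?_ ?_ ?_) le_rfl fun s' _ h => h.2.2)))) ?_
  · simp (disch := decide) [sqDist]
  · intro s' hf
    simp (disch := decide) [hf.nat]
  · intro i s' m h
    simpa (disch := decide) using h
  · rintro i hi s' hf - ⟨h1, h2, h3⟩
    refine Ends.le (Ends.setReal_seq (Ends.setNat_seq (Ends.setNat ⟨?_, ?_, ?_⟩))) (by simp)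
    · simp (disch := decide) [hf.nat, h1]
      ring
    · simp (disch := decide) [hf.nat, h2]
      ring
    · simp (disch := decide) [hf.real, h1, h2, h3, sqDist, Finset.sum_range_succ]
      ring
  · simp
    omega

/-- `real 6 := ` the signed sum of the coordinates of a point, which start at cell `nat 8`. -/
def rowProg : Program :=
  .seq (.assignReal 6 (.lit 0)) (.forTo 6 (.read 0 (.lit 1)) (.seq
    (.ite (.natLe (.lit 1) (.read 7 (.var 6)))
      (.assignReal 6 (.add (.var 6) (.read 1 (.var 8))))
      (.assignReal 6 (.sub (.var 6) (.read 1 (.var 8)))))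
    (.assign 8 (.add (.var 8) (.lit 1)))))

def signedSum (b : ℕ → ℕ) (x : ℕ → ℝ) (d m : ℕ) : ℝ :=
  ∑ j ∈ Finset.range d, if 1 ≤ b j then x (m + j) else -x (m + j)

theorem ends_rowProg (ω : ℕ → Bool) (s : State) :
    Ends ω rowProg s (43 * s.nat 0 1 + 20) fun s' =>
      s'.real 6 0 = signedSum (s.nat 7) (s.real 1) (s.nat 0 1) (s.nat 8 0) ∧
      s'.nat 8 0 = s.nat 8 0 + s.nat 0 1 := by
  refine Ends.le (Ends.setReal_seq (Ends.mono
    (Ends.forTo (c := 30) (N := s.nat 0 1) (fun i s' =>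
      s'.nat 8 0 = s.nat 8 0 + i ∧
      s'.real 6 0 = signedSum (s.nat 7) (s.real 1) i (s.nat 8 0))
      (by decide) ?_ ?_ ?_ ?_) le_rfl fun s' _ h => ⟨h.2, h.1⟩)) ?_
  · simp (disch := decide) [signedSum]
  · intro s' hf
    simp (disch := decide) [hf.nat]
  · intro i s' m h
    simpa (disch := decide) using h
  · rintro i hi s' hf hv ⟨h1, h2⟩
    refine Ends.le (Ends.seq (R := fun s₁ => s₁.real 6 0 =
      signedSum (s.nat 7) (s.real 1) (i + 1) (s.nat 8 0)) (Ends.ite (fun hb => Ends.setReal ?_)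
        (fun hb => Ends.setReal ?_)) fun s₁ hf₁ h3 => Ends.setNat ⟨?_, ?_⟩) (by simp)
    · simp (disch := decide) [hf.nat, hv] at hb
      simp (disch := decide) [hf.real, h1, h2, signedSum, Finset.sum_range_succ, hb]
    · simp (disch := decide) [hf.nat, hv] at hb
      simp (disch := decide) [hf.real, h1, h2, signedSum, Finset.sum_range_succ, hb]
      ring
    · simp (disch := decide) [hf₁.nat, h1]
      ring
    · simpa using h3
  · simp
    omega

/-- Appends the current row of signed sums of all points to `real 5`, from cell `nat 4`. -/
def pointsProg : Program :=
  .seq (.assign 8 (.lit 0)) (.forTo 9 (.var 0) (.seq rowProg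
    (.seq (.setReal 5 (.var 4) (.var 6)) (.assign 4 (.add (.var 4) (.lit 1))))))

theorem ends_pointsProg (ω : ℕ → Bool) (s : State) :
    Ends ω pointsProg s (s.nat 0 0 * (43 * s.nat 0 1 + 50) + 20) fun s' =>
      s'.nat 4 0 = s.nat 4 0 + s.nat 0 0 ∧ (∀ m < s.nat 4 0, s'.real 5 m = s.real 5 m) ∧
      ∀ q < s.nat 0 0, s'.real 5 (s.nat 4 0 + q) =
        signedSum (s.nat 7) (s.real 1) (s.nat 0 1) (q * s.nat 0 1) := by
  refine Ends.le (Ends.setNat_seq (Ends.mono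
    (Ends.forTo (c := 43 * s.nat 0 1 + 31) (N := s.nat 0 0) (fun i s' =>
      s'.nat 8 0 = i * s.nat 0 1 ∧ s'.nat 4 0 = s.nat 4 0 + i ∧
      (∀ m < s.nat 4 0, s'.real 5 m = s.real 5 m) ∧
      ∀ q < i, s'.real 5 (s.nat 4 0 + q) =
        signedSum (s.nat 7) (s.real 1) (s.nat 0 1) (q * s.nat 0 1))
      (by decide) ?_ ?_ ?_ ?_) le_rfl fun s' _ h => h.2)) ?_
  · simp (disch := decide)
  · intro s' hf
    simp (disch := decide) [hf.nat]
  · intro i s' m h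
    simpa (disch := decide) using h
  · rintro i hi s' hf hv ⟨h1, h2, h3, h4⟩
    refine Ends.le (Ends.seq (ends_rowProg ω s') fun s₁ hf₁ ⟨k1, k2⟩ =>
      Ends.setReal_seq (Ends.setNat ⟨?_, ?_, ?_, ?_⟩)) ?_
    · simp (disch := decide) [k2, h1, hf.nat]
      ring
    · simp (disch := decide) [hf₁.nat, h2]
      ring
    · intro m hm
      have : m ≠ s.nat 4 0 + i := by omega
      simp (disch := decide) [hf₁.nat, hf₁.real, h2, Function.update_apply, this, h3 m hm]
    · intro q hq
      rcases Nat.lt_succ_iff_lt_or_eq.1 hq with hq | rfl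
      · have : q ≠ i := by omega
        simp (disch := decide) [hf₁.nat, hf₁.real, h2, Function.update_apply, this, h4 q hq]
      · simp (disch := decide) [hf₁.nat, h2, k1, hf.nat, hf.real, h1]
    · simp (disch := decide) [hf.nat]
  · simp
    nlinarith

/-- Tosses one coin for each coordinate, into `nat 7`. -/
def tossProg : Program :=
  .forTo 6 (.read 0 (.lit 1)) (.toss 7 (.var 6))

theorem ends_tossProg (ω : ℕ → Bool) (s : State) :
    Ends ω tossProg s (16 * s.nat 0 1 + 10) fun s' =>
      s'.used = s.used + s.nat 0 1 ∧ ∀ j < s.nat 0 1, s'.nat 7 j = (ω (s.used + j)).toNat := by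
  refine Ends.le (Ends.forTo (c := 3) (N := s.nat 0 1) (fun i s' => s'.used = s.used + i ∧
    ∀ j < i, s'.nat 7 j = (ω (s.used + j)).toNat) (by decide) ?_ ?_ ?_ ?_) ?_
  · simp
  · intro s' hf
    simp (disch := decide) [hf.nat]
  · intro i s' m h
    simpa (disch := decide) using h
  · rintro i hi s' hf hv ⟨h1, h2⟩
    refine Ends.le (Ends.toss ⟨?_, ?_⟩) (by simp)
    · simp [h1]
      ring
    · intro j hj
      rcases Nat.lt_succ_iff_lt_or_eq.1 hj with hj | rfl
      · have : j ≠ i := by omega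
        simp [hv, this, h2 j hj]
      · simp [hv, h1]
  · simp
    omega

/-- The random projection of all points to dimension `nat 3`, into `real 5`. -/
def projProg : Program :=
  .seq (.assign 4 (.lit 0)) (.forTo 5 (.var 3) (.seq tossProg pointsProg))

theorem signedSum_congr {b b' : ℕ → ℕ} {x : ℕ → ℝ} {d m : ℕ} (h : ∀ j < d, b j = b' j) :
    signedSum b x d m = signedSum b' x d m :=
  Finset.sum_congr rfl fun j hj => by rw [h j (Finset.mem_range.1 hj)]

/-- Row `l` of the sign matrix consists of the coins from `l * d` on, because no coin was tossed
before; all points share the d signs of the current row. -/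
theorem ends_projProg (ω : ℕ → Bool) (s : State) (hs : s.used = 0) :
    Ends ω projProg s
      (s.nat 3 0 * (s.nat 0 0 * (43 * s.nat 0 1 + 50) + 16 * s.nat 0 1 + 45) + 20) fun s' =>
      ∀ l < s.nat 3 0, ∀ q < s.nat 0 0, s'.real 5 (l * s.nat 0 0 + q) =
        signedSum (fun j => (ω (l * s.nat 0 1 + j)).toNat) (s.real 1) (s.nat 0 1)
          (q * s.nat 0 1) := by
  refine Ends.le (Ends.setNat_seq (Ends.mono
    (Ends.forTo (c := s.nat 0 0 * (43 * s.nat 0 1 + 50) + 16 * s.nat 0 1 + 30) (N := s.nat 3 0)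
      (fun i s' => s'.nat 4 0 = i * s.nat 0 0 ∧ s'.used = i * s.nat 0 1 ∧
      ∀ l < i, ∀ q < s.nat 0 0, s'.real 5 (l * s.nat 0 0 + q) =
        signedSum (fun j => (ω (l * s.nat 0 1 + j)).toNat) (s.real 1) (s.nat 0 1)
          (q * s.nat 0 1))
      (by decide) ?_ ?_ ?_ ?_) le_rfl fun s' _ h => h.2.2)) ?_
  · simp (disch := decide) [hs]
  · intro s' hf
    simp (disch := decide) [hf.nat]
  · intro i s' m h
    simpa (disch := decide) using h
  · rintro i hi s' hf hv ⟨h1, h2, h3⟩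
    have e0 : s'.nat 0 = s.nat 0 := by simp (disch := decide) [hf.nat]
    have er : s'.real 1 = s.real 1 := by simp (disch := decide) [hf.real]
    rw [← e0] at h1 h2 h3 ⊢
    refine Ends.le (Ends.seq (ends_tossProg ω s') fun s₁ hf₁ ⟨k1, k2⟩ =>
      Ends.mono (ends_pointsProg ω s₁) (T' := s'.nat 0 0 * (43 * s'.nat 0 1 + 50) + 20) ?_
        fun s₂ hf₂ ⟨m1, m2, m3⟩ => ⟨?_, ?_, ?_⟩) ?_
    · simp (disch := decide) [hf₁.nat]
    · simp (disch := decide) [m1, hf₁.nat, h1]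
      ring
    · simp (disch := decide) [hf₂.used, k1, h2]
      ring
    · simp (disch := decide) only [hf₁.nat, hf₁.real, h1] at m2 m3
      intro l hl q hq
      rcases Nat.lt_succ_iff_lt_or_eq.1 hl with hl | rfl
      · rw [m2 _ (by nlinarith), h3 l hl q hq]
      · rw [m3 q hq, er]
        refine signedSum_congr fun j hj => ?_
        rw [k2 j hj, h2]
    · omega
  · simp
    nlinarith

/-! ### Choice of the projection dimension. -/

/-- `real 3 := ⌈log₂ n⌉`, by repeated doubling of `nat 2`. -/
def logProg : Program :=
  .seq (.assign 2 (.lit 1)) (.seq (.assignReal 3 (.lit 0))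
    (.loop (.not (.natLe (.var 0) (.var 2)))
      (.seq (.assign 2 (.add (.var 2) (.var 2))) (.assignReal 3 (.add (.var 3) (.lit 1))))))

theorem ends_logProg (ω : ℕ → Bool) (s : State) :
    Ends ω logProg s (21 * Nat.clog 2 (s.nat 0 0) + 20) fun s' =>
      s'.real 3 0 = Nat.clog 2 (s.nat 0 0) := by
  refine Ends.le (Ends.setNat_seq (Ends.setReal_seq (Ends.mono
    (Ends.loop (c := 14) (Nat.clog 2 (s.nat 0 0)) (fun i s' => s'.nat 2 0 = 2 ^ i ∧ s'.real 3 0 = i)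
      ?_ ?_ ?_) le_rfl fun s' _ h => h.2))) ?_
  · simp (disch := decide)
  · rintro i hi s' hf ⟨h1, h2⟩
    refine ⟨?_, Ends.le (Ends.setNat_seq (Ends.setReal ⟨?_, ?_⟩)) (by simp)⟩
    · have := (Nat.lt_clog_iff_pow_lt one_lt_two).1 hi
      simp (disch := decide) [hf.nat, h1, this]
    · simp [h1]
      ring
    · simp [h2]
  · rintro s' hf ⟨h1, -⟩
    have := Nat.le_pow_clog one_lt_two (s.nat 0 0)
    simp (disch := decide) [hf.nat, h1, this]
  · simp
    omega

/-- `nat 3 := ` the least `k` with `c * L ≤ k * ε²`, where `L` is in `real 3`. -/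
def dimProg (c : ℕ) : Program :=
  .seq (.assign 3 (.lit 0)) (.seq (.assignReal 4 (.lit 0))
    (.loop (.not (.realLe (.mul (.lit c) (.var 3)) (.mul (.var 4) (.mul (.var 0) (.var 0)))))
      (.seq (.assign 3 (.add (.var 3) (.lit 1))) (.assignReal 4 (.add (.var 4) (.lit 1))))))

/-- The counter is kept both as a natural number, for later loops, and as a real, for the test, as
the machine cannot convert one into the other. The linear search costs only O(k). -/
theorem ends_dimProg (ω : ℕ → Bool) (s : State) (c : ℕ) (hε : 0 < s.real 0 0) :
    Ends ω (dimProg c) s (30 * ⌈c * s.real 3 0 / s.real 0 0 ^ 2⌉₊ + 30) fun s' =>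
      s'.nat 3 0 = ⌈c * s.real 3 0 / s.real 0 0 ^ 2⌉₊ := by
  refine Ends.le (Ends.setNat_seq (Ends.setReal_seq (Ends.mono
    (Ends.loop (c := 14) ⌈c * s.real 3 0 / s.real 0 0 ^ 2⌉₊
      (fun i s' => s'.nat 3 0 = i ∧ s'.real 4 0 = i)
      ?_ ?_ ?_) le_rfl fun s' _ h => h.1))) ?_
  · simp (disch := decide)
  · rintro i hi s' hf ⟨h1, h2⟩
    have e0 : s'.real 0 = s.real 0 := by
      rw [hf.real (by simp [Program.realWrites])]; simp (disch := decide)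
    have e3 : s'.real 3 = s.real 3 := by
      rw [hf.real (by simp [Program.realWrites])]; simp (disch := decide)
    refine ⟨?_, Ends.le (Ends.setNat_seq (Ends.setReal ⟨?_, ?_⟩)) (by simp)⟩
    · have := Nat.lt_ceil.1 hi
      rw [lt_div_iff₀ (by positivity)] at this
      simp [e0, e3, h2]
      linarith
    · simp [h1]
    · simp [h2]
  · rintro s' hf ⟨-, h2⟩
    have e0 : s'.real 0 = s.real 0 := by
      rw [hf.real (by simp [Program.realWrites])]; simp (disch := decide)
    have e3 : s'.real 3 = s.real 3 := by
      rw [hf.real (by simp [Program.realWrites])]; simp (disch := decide)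
    have := Nat.le_ceil (c * s.real 3 0 / s.real 0 0 ^ 2)
    rw [div_le_iff₀ (by positivity)] at this
    simp [e0, e3, h2]
    linarith
  · simp
    omega

/-! ### The greedy invariant. -/

/-- The invariant of the farthest-point heuristic after the choice of `T` centers `S`: the
array `D` has squared distances to the nearest center, and `-1` at the centers. -/
structure Greedy (dd : ℕ → ℕ → ℝ) (n T : ℕ) (S cl : ℕ → ℕ) (D : ℕ → ℝ) : Prop where
  center_lt : ∀ t < T, S t < n
  center : ∀ t < T, cl (S t) = t ∧ D (S t) = -1
  cl_lt : ∀ q < n, cl q < T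
  near : ∀ q < n, ∀ t < T, dd q (S (cl q)) ≤ dd q (S t)
  free : ∀ q < n, (∃ t < T, S t = q) ∨
    (D q = dd q (S (cl q)) ∧ ∀ t < T, ∀ u < T, t ≠ u → D q ≤ dd (S t) (S u))

theorem Greedy.init {dd : ℕ → ℕ → ℝ} {n : ℕ} {S cl : ℕ → ℕ} {D : ℕ → ℝ} (hn : 0 < n)
    (hc : ∀ a b, dd a b = dd b a) (hS : S 0 = 0)
    (hcl : ∀ q < n, cl q = 0) (h0 : D 0 = -1) (hD : ∀ q < n, q ≠ 0 → D q = dd 0 q) :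
    Greedy dd n 1 S cl D where
  center_lt t ht := by
    obtain rfl : t = 0 := by omega
    omega
  center t ht := by
    obtain rfl : t = 0 := by omega
    rw [hS]
    exact ⟨hcl 0 hn, h0⟩
  cl_lt q hq := by rw [hcl q hq]; exact one_pos
  near q hq t ht := by
    obtain rfl : t = 0 := by omega
    rw [hcl q hq]
  free q hq := by
    by_cases h : q = 0
    · exact .inl ⟨0, one_pos, by omega⟩
    · refine .inr ⟨by rw [hD q hq h, hcl q hq, hS, hc], fun t ht u hu => by omega⟩

/-- The new separation holds because the largest value `D c` is the distance from `c` to its nearest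
old center and is at most every old separation, while stored distances of non-centers only decrease.
The mark -1 makes centers unattractive for the maximum and lets them pass the test, so they keep
their labels even when points coincide. -/
theorem Greedy.step {dd : ℕ → ℕ → ℝ} {n T : ℕ} {S cl S' cl' : ℕ → ℕ} {D D' : ℕ → ℝ}
    (h : Greedy dd n T S cl D) (hc : ∀ a b, dd a b = dd b a) (h0 : ∀ a, dd a a = 0)
    (hp : ∀ a b, 0 ≤ dd a b) (hT : T < n) {c : ℕ} (hcn : c < n) (hmax : ∀ q < n, D q ≤ D c)
    (hS : S' = Function.update S T c)
    (hcl : ∀ q < n, cl' q =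
      if Function.update D c (-1) q ≤ dd c q then Function.update cl c T q else T)
    (hD : ∀ q < n, D' q =
      if Function.update D c (-1) q ≤ dd c q then Function.update D c (-1) q else dd c q) :
    Greedy dd n (T + 1) S' cl' D' := by
  -- As T < n, some index is not yet a center; its stored distance is nonnegative, hence so is the
  -- maximum, and `c` is not marked.
  have hex : ∃ q < n, ∀ t < T, S t ≠ q := by
    by_contra! hall
    have : Finset.range n ⊆ (Finset.range T).image S := by
      intro q hq
      obtain ⟨t, ht, e⟩ := hall q (Finset.mem_range.1 hq)
      exact Finset.mem_image.2 ⟨t, Finset.mem_range.2 ht, e⟩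
    have := (Finset.card_le_card this).trans Finset.card_image_le
    simp at this
    omega
  have hDc : 0 ≤ D c := by
    obtain ⟨q, hq, hne⟩ := hex
    rcases h.free q hq with ⟨t, ht, e⟩ | ⟨e, -⟩
    · exact absurd e (hne t ht)
    · exact (e ▸ hp _ _).trans (hmax q hq)
  have hSc : ∀ t < T, S t ≠ c := by
    intro t ht e
    have := (h.center t ht).2
    rw [e] at this
    linarith
  obtain ⟨ec, hsep⟩ : D c = dd c (S (cl c)) ∧ ∀ t < T, ∀ u < T, t ≠ u → D c ≤ dd (S t) (S u) := by
    rcases h.free c hcn with ⟨t, ht, e⟩ | h'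
    · exact absurd e (hSc t ht)
    · exact h'
  have hlt : ∀ t < T, S' t = S t := fun t ht => by
    rw [hS, Function.update_of_ne (by omega)]
  have hTc : S' T = c := by rw [hS, Function.update_self]
  have hcent : ∀ t < T + 1, cl' (S' t) = t ∧ D' (S' t) = -1 := by
    intro t ht
    rcases Nat.lt_succ_iff_lt_or_eq.1 ht with ht | rfl
    · have h1 := h.center t ht
      have h2 : (-1 : ℝ) ≤ dd c (S t) := by linarith [hp c (S t)]
      rw [hlt t ht, hcl _ (h.center_lt t ht), hD _ (h.center_lt t ht),
        Function.update_of_ne (hSc t ht), Function.update_of_ne (hSc t ht), h1.2]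
      simp [h2, h1.1]
    · have h2 : (-1 : ℝ) ≤ dd c c := by linarith [hp c c]
      rw [hTc, hcl _ hcn, hD _ hcn]
      simp [h2]
  have hfree : ∀ q < n, (∀ t < T + 1, S' t ≠ q) → q ≠ c ∧ D q = dd q (S (cl q)) ∧
      cl' q = (if D q ≤ dd c q then cl q else T) ∧
      D' q = if D q ≤ dd c q then D q else dd c q := by
    intro q hq hne
    have hqc : q ≠ c := fun e => hne T (by omega) (hTc.trans e.symm)
    refine ⟨hqc, ?_, ?_, ?_⟩
    · rcases h.free q hq with ⟨t, ht, e⟩ | h'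
      · exact absurd ((hlt t ht).trans e) (hne t (by omega))
      · exact h'.1
    · rw [hcl q hq, Function.update_of_ne hqc, Function.update_of_ne hqc]
    · rw [hD q hq, Function.update_of_ne hqc]
  refine ⟨?_, hcent, ?_, ?_, ?_⟩
  · intro t ht
    rcases Nat.lt_succ_iff_lt_or_eq.1 ht with ht | rfl
    · rw [hlt t ht]
      exact h.center_lt t ht
    · rwa [hTc]
  · intro q hq
    have := h.cl_lt q hq
    rw [hcl q hq]
    split_ifs
    · rw [Function.update_apply]
      split_ifs <;> omega
    · omega
  · intro q hq t ht
    by_cases hch : ∃ u < T + 1, S' u = q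
    · obtain ⟨u, hu, rfl⟩ := hch
      rw [(hcent u hu).1, h0]
      exact hp _ _
    · push Not at hch
      obtain ⟨-, e1, e2, -⟩ := hfree q hq hch
      rw [e2]
      split_ifs with hle
      · rw [hlt _ (h.cl_lt q hq)]
        rcases Nat.lt_succ_iff_lt_or_eq.1 ht with ht | rfl
        · rw [hlt t ht]
          exact h.near q hq t ht
        · rw [hTc, ← e1, hc q c]
          exact hle
      · rw [hTc]
        rcases Nat.lt_succ_iff_lt_or_eq.1 ht with ht | rfl
        · rw [hlt t ht, hc q c]
          exact (le_of_not_ge hle).trans (e1.trans_le (h.near q hq t ht))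
        · rw [hTc]
  · intro q hq
    by_cases hch : ∃ u < T + 1, S' u = q
    · exact .inl hch
    · push Not at hch
      obtain ⟨-, e1, e2, e3⟩ := hfree q hq hch
      right
      constructor
      · rw [e2, e3]
        split_ifs with hle
        · rw [hlt _ (h.cl_lt q hq), e1]
        · rw [hTc, hc]
      · have h1 : D' q ≤ D c := by
          refine le_trans ?_ (hmax q hq)
          rw [e3]
          split_ifs with hle
          · exact le_rfl
          · exact le_of_not_ge hle
        intro t ht u hu htu
        refine h1.trans ?_
        rcases Nat.lt_succ_iff_lt_or_eq.1 ht with ht | rfl <;>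
          rcases Nat.lt_succ_iff_lt_or_eq.1 hu with hu | rfl
        · rw [hlt t ht, hlt u hu]
          exact hsep t ht u hu htu
        · rw [hlt t ht, hTc, hc, ec]
          exact h.near c hcn t ht
        · rw [hlt u hu, hTc, ec]
          exact h.near c hcn u hu
        · exact absurd rfl htu

theorem Greedy.separated {dd : ℕ → ℕ → ℝ} {n T : ℕ} {S cl : ℕ → ℕ} {D : ℕ → ℝ}
    (h : Greedy dd n T S cl D) (h0 : ∀ a, dd a a = 0) (hp : ∀ a b, 0 ≤ dd a b) {q t u : ℕ}
    (hq : q < n) (ht : t < T) (hu : u < T) (htu : t ≠ u) :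
    dd q (S (cl q)) ≤ dd (S t) (S u) := by
  rcases h.free q hq with ⟨v, hv, rfl⟩ | ⟨e, hs⟩
  · rw [(h.center v hv).1, h0]
    exact hp _ _
  · rw [← e]
    exact hs t ht u hu htu

theorem sqDist_comm (y : ℕ → ℝ) (n k a b : ℕ) : sqDist y n k a b = sqDist y n k b a :=
  Finset.sum_congr rfl fun _ _ => by ring

theorem sqDist_self (y : ℕ → ℝ) (n k a : ℕ) : sqDist y n k a a = 0 := by simp [sqDist]

theorem sqDist_nonneg (y : ℕ → ℝ) (n k a b : ℕ) : 0 ≤ sqDist y n k a b :=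
  Finset.sum_nonneg fun _ _ => sq_nonneg _

/-! ### Programs for the heuristic and for the output. -/

/-- The first point becomes the first center. -/
def initProg : Program :=
  .seq (.assign 11 (.lit 0)) (.seq
    (.forTo 9 (.var 0) (.seq distProg
      (.seq (.setReal 7 (.var 9) (.var 6)) (.setNat 1 (.var 9) (.lit 0)))))
    (.seq (.setReal 7 (.lit 0) (.sub (.lit 0) (.lit 1))) (.setNat 12 (.lit 0) (.lit 0))))

theorem ends_initProg (ω : ℕ → Bool) (s : State) (hn : 0 < s.nat 0 0) :
    Ends ω initProg s (s.nat 0 0 * (47 * s.nat 3 0 + 60) + 40) fun s' =>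
      Greedy (sqDist (s.real 5) (s.nat 0 0) (s.nat 3 0)) (s.nat 0 0) 1 (s'.nat 12) (s'.nat 1)
        (s'.real 7) := by
  refine Ends.le (Ends.setNat_seq (Ends.seq
    (Ends.forTo (c := 47 * s.nat 3 0 + 40) (N := s.nat 0 0) (fun i s' =>
      ∀ q < i, s'.nat 1 q = 0 ∧ s'.real 7 q = sqDist (s.real 5) (s.nat 0 0) (s.nat 3 0) 0 q)
      (by decide) ?_ ?_ ?_ ?_) fun s₁ hf h => Ends.setReal_seq (Ends.setNat ?_))) ?_
  · simp
  · intro s' hf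
    simp (disch := decide) [hf.nat]
  · intro i s' m h
    simpa (disch := decide) using h
  · rintro i hi s' hf hv h1
    refine Ends.le (Ends.seq (ends_distProg ω s') fun s₁ hf₁ k => Ends.setReal_seq (Ends.setNat ?_))
      ?_
    · intro q hq
      simp (disch := decide) [hf.nat, hf.real, hv] at k
      rcases Nat.lt_succ_iff_lt_or_eq.1 hq with hq | rfl
      · have : q ≠ i := by omega
        simpa (disch := decide) [hf₁.nat, hf₁.real, hv, this, Function.update_apply] using h1 q hq
      · simp (disch := decide) [hf₁.nat, hv, k]
    · simp (disch := decide) [hf.nat]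
  · refine Greedy.init hn (sqDist_comm _ _ _) (by simp) (fun q hq => ?_) (by simp)
      fun q hq h0 => ?_
    · simpa (disch := decide) using (h q hq).1
    · simpa (disch := decide) [Function.update_apply, h0] using (h q hq).2
  · simp
    nlinarith

/-- `nat 11 := ` a position of the maximum of `real 7`. -/
def argmaxProg : Program :=
  .seq (.assign 11 (.lit 0)) (.forTo 9 (.var 0)
    (.ite (.realLe (.read 7 (.var 9)) (.read 7 (.var 11))) (.assign 11 (.var 11))
      (.assign 11 (.var 9))))

theorem ends_argmaxProg (ω : ℕ → Bool) (s : State) (hn : 0 < s.nat 0 0) :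
    Ends ω argmaxProg s (s.nat 0 0 * 40 + 20) fun s' =>
      s'.nat 11 0 < s.nat 0 0 ∧ ∀ q < s.nat 0 0, s.real 7 q ≤ s.real 7 (s'.nat 11 0) := by
  refine Ends.le (Ends.setNat_seq (Ends.forTo (c := 20) (N := s.nat 0 0) (fun i s' =>
      s'.nat 11 0 < s.nat 0 0 ∧ ∀ q < i, s.real 7 q ≤ s.real 7 (s'.nat 11 0))
      (by decide) ?_ ?_ ?_ ?_)) ?_
  · simp [hn]
  · intro s' hf
    simp (disch := decide) [hf.nat]
  · intro i s' m h
    simpa (disch := decide) using h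
  · rintro i hi s' hf hv ⟨h1, h2⟩
    refine Ends.le (Ends.ite (fun hb => Ends.setNat ⟨?_, ?_⟩) (fun hb => Ends.setNat ⟨?_, ?_⟩))
      (by simp)
    · simpa using h1
    · simp (disch := decide) [hf.real, hv] at hb ⊢
      intro q hq
      rcases Nat.lt_or_eq_of_le hq with hq | rfl
      · exact h2 q hq
      · exact hb
    · simpa [hv] using hi
    · simp (disch := decide) [hf.real, hv] at hb ⊢
      intro q hq
      rcases Nat.lt_or_eq_of_le hq with hq | rfl
      · exact (h2 q hq).trans hb.le
      · exact le_rfl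
  · simp
    nlinarith

/-- Assigns points to the new center `nat 11`, with label `nat 10 + 1`, if it is nearer. -/
def updateProg : Program :=
  .forTo 9 (.var 0) (.seq distProg
    (.ite (.realLe (.read 7 (.var 9)) (.var 6)) (.assign 13 (.var 13))
      (.seq (.setReal 7 (.var 9) (.var 6)) (.setNat 1 (.var 9) (.add (.var 10) (.lit 1))))))

/-- The loop overwrites the arrays it reads, so the invariant also records that cells from `i` on
are still untouched. The assignment of variable 13 to itself serves as a skip. -/
theorem ends_updateProg (ω : ℕ → Bool) (s : State) :
    Ends ω updateProg s (s.nat 0 0 * (47 * s.nat 3 0 + 80) + 20) fun s' =>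
      ∀ q < s.nat 0 0,
        s'.nat 1 q = (if s.real 7 q ≤ sqDist (s.real 5) (s.nat 0 0) (s.nat 3 0) (s.nat 11 0) q
          then s.nat 1 q else s.nat 10 0 + 1) ∧
        s'.real 7 q = (if s.real 7 q ≤ sqDist (s.real 5) (s.nat 0 0) (s.nat 3 0) (s.nat 11 0) q
          then s.real 7 q else sqDist (s.real 5) (s.nat 0 0) (s.nat 3 0) (s.nat 11 0) q) := by
  refine Ends.le (Ends.mono (Ends.forTo (c := 47 * s.nat 3 0 + 60) (N := s.nat 0 0) (fun i s' =>
      (∀ q < i,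
        s'.nat 1 q = (if s.real 7 q ≤ sqDist (s.real 5) (s.nat 0 0) (s.nat 3 0) (s.nat 11 0) q
          then s.nat 1 q else s.nat 10 0 + 1) ∧
        s'.real 7 q = (if s.real 7 q ≤ sqDist (s.real 5) (s.nat 0 0) (s.nat 3 0) (s.nat 11 0) q
          then s.real 7 q else sqDist (s.real 5) (s.nat 0 0) (s.nat 3 0) (s.nat 11 0) q)) ∧
      ∀ q, i ≤ q → s'.nat 1 q = s.nat 1 q ∧ s'.real 7 q = s.real 7 q)
      (by decide) ?_ ?_ ?_ ?_) le_rfl fun s' _ h => h.1) ?_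
  · simp
  · intro s' hf
    simp (disch := decide) [hf.nat]
  · intro i s' m h
    simpa (disch := decide) using h
  · rintro i hi s' hf hv ⟨h1, h2⟩
    have hi1 := (h2 i le_rfl).1
    have hi2 := (h2 i le_rfl).2
    have hd := ends_distProg ω s'
    simp (disch := decide) only [hf.nat, hf.real, hv] at hd
    refine Ends.le (Ends.seq hd fun s₁ hf₁ k =>
      Ends.ite (fun hb => Ends.setNat ⟨fun q hq => ?_, fun q hq => ?_⟩)
        (fun hb => Ends.setReal_seq (Ends.setNat ⟨fun q hq => ?_, fun q hq => ?_⟩))) ?_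
    · simp (disch := decide) [hf₁.nat, hf₁.real, hv, hi2, k] at hb ⊢
      rcases Nat.lt_succ_iff_lt_or_eq.1 hq with hq | rfl
      · exact h1 q hq
      · simp [hb, hi1, hi2]
    · simpa (disch := decide) [hf₁.nat, hf₁.real] using h2 q (by omega)
    · simp (disch := decide) [hf₁.nat, hf₁.real, hv, hi2, k, hf.nat] at hb ⊢
      rcases Nat.lt_succ_iff_lt_or_eq.1 hq with hq | rfl
      · have : q ≠ i := by omega
        simpa [Function.update_apply, this] using h1 q hq
      · simp [not_le.2 hb]
    · have : q ≠ i := by omega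
      simpa (disch := decide) [hf₁.nat, hf₁.real, hv, Function.update_apply, this] using
        h2 q (by omega)
    · simp (disch := decide)
  · simp
    nlinarith

/-- Chooses the center with label `nat 10 + 1`. -/
def stepProg : Program :=
  .seq argmaxProg (.seq (.setNat 12 (.add (.var 10) (.lit 1)) (.var 11))
    (.seq (.setNat 1 (.var 11) (.add (.var 10) (.lit 1)))
      (.seq (.setReal 7 (.var 11) (.sub (.lit 0) (.lit 1))) updateProg)))

theorem ends_stepProg (ω : ℕ → Bool) (s : State) (hn : s.nat 10 0 + 1 < s.nat 0 0)
    (h : Greedy (sqDist (s.real 5) (s.nat 0 0) (s.nat 3 0)) (s.nat 0 0) (s.nat 10 0 + 1)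
      (s.nat 12) (s.nat 1) (s.real 7)) :
    Ends ω stepProg s (s.nat 0 0 * (47 * s.nat 3 0 + 120) + 80) fun s' =>
      Greedy (sqDist (s.real 5) (s.nat 0 0) (s.nat 3 0)) (s.nat 0 0) (s.nat 10 0 + 1 + 1)
        (s'.nat 12) (s'.nat 1) (s'.real 7) := by
  refine Ends.le (Ends.seq (ends_argmaxProg ω s (by omega)) fun s₁ hf₁ ⟨k1, k2⟩ =>
    Ends.setNat_seq (Ends.setNat_seq (Ends.setReal_seq (Ends.mono (ends_updateProg ω _)
      (T' := s.nat 0 0 * (47 * s.nat 3 0 + 80) + 20) ?_ fun s₂ hf₂ h2 => ?_)))) ?_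
  · simp (disch := decide) [hf₁.nat]
  · simp (disch := decide) [hf₁.nat, hf₁.real] at h2
    refine h.step (sqDist_comm _ _ _) (sqDist_self _ _ _) (sqDist_nonneg _ _ _) hn k1 k2 ?_
      (fun q hq => (h2 q hq).1) (fun q hq => (h2 q hq).2)
    simp (disch := decide) [hf₂.nat, hf₁.nat]
  · simp
    nlinarith

/-- The farthest-point heuristic: the centers go to `nat 12`, the assignment to `nat 1`. -/
def greedyProg : Program :=
  .seq initProg (.forTo 10 (.sub (.read 0 (.lit 2)) (.lit 1)) stepProg)

theorem ends_greedyProg (ω : ℕ → Bool) (s : State) (hl : 0 < s.nat 0 2)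
    (hn : s.nat 0 2 < s.nat 0 0) :
    Ends ω greedyProg s (s.nat 0 2 * (s.nat 0 0 * (47 * s.nat 3 0 + 120) + 100) + 60) fun s' =>
      ∃ D, Greedy (sqDist (s.real 5) (s.nat 0 0) (s.nat 3 0)) (s.nat 0 0) (s.nat 0 2)
        (s'.nat 12) (s'.nat 1) D := by
  refine Ends.le (Ends.seq (ends_initProg ω s (by omega)) fun s₁ hf₁ h1 => Ends.mono
    -- The first center is already there, so ℓ - 1 rounds remain and round `i` starts with `i + 1`
    -- centers.
    (Ends.forTo (c := s.nat 0 0 * (47 * s.nat 3 0 + 120) + 80) (N := s.nat 0 2 - 1) (fun i s' =>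
      Greedy (sqDist (s.real 5) (s.nat 0 0) (s.nat 3 0)) (s.nat 0 0) (i + 1)
        (s'.nat 12) (s'.nat 1) (s'.real 7)) (by decide) h1 ?_ ?_ ?_) le_rfl
      fun s' _ h => ⟨s'.real 7, ?_⟩) ?_
  · intro s' hf
    simp (disch := decide) [hf.nat, hf₁.nat]
  · intro i s' m h
    simpa (disch := decide) using h
  · rintro i hi s' hf hv h
    have h2 := ends_stepProg ω s'
    simp (disch := decide) only [hf.nat, hf.real, hf₁.nat, hf₁.real, hv] at h2
    exact h2 (by omega) h
  · rwa [Nat.sub_add_cancel hl] at h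
  · obtain ⟨m, hm⟩ : ∃ m, s.nat 0 2 = m + 1 := ⟨s.nat 0 2 - 1, by omega⟩
    simp [hm]
    nlinarith

/-- Writes the chosen points to `real 2`. -/
def outProg : Program :=
  .seq (.assign 15 (.lit 0)) (.forTo 10 (.read 0 (.lit 2))
    (.seq (.assign 8 (.lit 0))
      (.seq (.forTo 9 (.read 12 (.var 10)) (.assign 8 (.add (.var 8) (.read 0 (.lit 1)))))
        (.forTo 6 (.read 0 (.lit 1)) (.seq (.setReal 2 (.var 15) (.read 1 (.var 8)))
          (.seq (.assign 15 (.add (.var 15) (.lit 1))) (.assign 8 (.add (.var 8) (.lit 1)))))))))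

/-- The address of a chosen point is found by adding d as often as its index says. The hypothesis
bounds this by n additions per center, which accounts for the ℓ n term. -/
theorem ends_outProg (ω : ℕ → Bool) (s : State) (hS : ∀ t < s.nat 0 2, s.nat 12 t < s.nat 0 0) :
    Ends ω outProg s (s.nat 0 2 * (25 * s.nat 0 0 + 40 * s.nat 0 1 + 80) + 40) fun s' =>
      ∀ t < s.nat 0 2, ∀ j < s.nat 0 1,
        s'.real 2 (t * s.nat 0 1 + j) = s.real 1 (s.nat 12 t * s.nat 0 1 + j) := by
  refine Ends.le (Ends.setNat_seq (Ends.mono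
    (Ends.forTo (c := 25 * s.nat 0 0 + 40 * s.nat 0 1 + 60) (N := s.nat 0 2) (fun i s' =>
      s'.nat 15 0 = i * s.nat 0 1 ∧ ∀ t < i, ∀ j < s.nat 0 1,
        s'.real 2 (t * s.nat 0 1 + j) = s.real 1 (s.nat 12 t * s.nat 0 1 + j))
      (by decide) ?_ ?_ ?_ ?_) le_rfl fun s' _ h => h.2)) ?_
  · simp
  · intro s' hf
    simp (disch := decide) [hf.nat]
  · intro i s' m h
    simpa (disch := decide) using h
  · rintro i hi s' hf hv ⟨h1, h2⟩
    have hSi := hS i hi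
    refine Ends.le (Ends.setNat_seq (Ends.seq
      (Ends.forTo (c := 8) (N := s.nat 12 i) (fun m s₁ => s₁.nat 8 0 = m * s.nat 0 1)
        (by decide) ?_ ?_ ?_ ?_) fun s₁ hf₁ k => Ends.mono
      (Ends.forTo (c := 21) (N := s.nat 0 1) (fun m s₂ =>
        s₂.nat 8 0 = s.nat 12 i * s.nat 0 1 + m ∧ s₂.nat 15 0 = i * s.nat 0 1 + m ∧
        (∀ a < i * s.nat 0 1, s₂.real 2 a = s'.real 2 a) ∧
        ∀ j < m, s₂.real 2 (i * s.nat 0 1 + j) = s.real 1 (s.nat 12 i * s.nat 0 1 + j))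
        (by decide) ?_ ?_ ?_ ?_) le_rfl fun s₂ hf₂ ⟨m1, m2, m3, m4⟩ => ⟨?_, ?_⟩)) ?_
    · simp
    · intro s₁ hf₁
      simp (disch := decide) [hf₁.nat, hf.nat, hv]
    · intro m s₁ x h
      simpa (disch := decide) using h
    · rintro m hm s₁ hf₁ - k
      refine Ends.le (Ends.setNat ?_) (by simp)
      simp (disch := decide) [hf₁.nat, hf.nat, k]
      ring
    · simp (disch := decide) [k, hf₁.nat, hf₁.real, h1]
    · intro s₂ hf₂
      simp (disch := decide) [hf₂.nat, hf₁.nat, hf.nat]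
    · intro m s₁ x h
      simpa (disch := decide) using h
    · rintro m hm s₂ hf₂ - ⟨m1, m2, m3, m4⟩
      refine Ends.le (Ends.setReal_seq (Ends.setNat_seq (Ends.setNat ⟨?_, ?_, ?_, ?_⟩))) (by simp)
      · simp (disch := decide) [m1]
        ring
      · simp (disch := decide) [m2]
        ring
      · intro a ha
        have : a ≠ i * s.nat 0 1 + m := by omega
        simp (disch := decide) [m2, Function.update_apply, this, m3 a ha]
      · intro j hj
        rcases Nat.lt_succ_iff_lt_or_eq.1 hj with hj | rfl
        · have : j ≠ m := by omega
          simp (disch := decide) [m2, Function.update_apply, this, m4 j hj]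
        · simp (disch := decide) [m2, m1, hf₂.real, hf₁.real, hf.real]
    · rw [m2]
      ring
    · intro t ht j hj
      rcases Nat.lt_succ_iff_lt_or_eq.1 ht with ht | rfl
      · rw [m3 _ (by nlinarith), h2 t ht j hj]
      · exact m4 j hj
    · simp
      nlinarith
  · simp
    nlinarith

/-! ### The whole algorithm: correctness, running time and constants. -/

open Clustering JL

/-- The whole algorithm; `c` determines the dimension of the projection. -/
def clusterProg (c : ℕ) : Program :=
  .seq logProg (.seq (dimProg c) (.seq projProg (.seq greedyProg outProg)))

section Input

variable {n d : ℕ} (ℓ : ℕ) (ε : ℝ) (p : Fin n → EuclideanSpace ℝ (Fin d))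

theorem input_real_one (q : Fin n) (j : Fin d) :
    (input ℓ ε p).real 1 (q * d + j) = p q j := by
  have h : (q : ℕ) * d + j < n * d := by
    have := Nat.mul_le_mul_right d (Nat.succ_le_of_lt q.2)
    rw [Nat.succ_mul] at this
    omega
  have hd : 0 < d := j.pos
  have h1 : Fin.divNat ⟨q * d + j, h⟩ = q := by
    ext
    simp only [Fin.coe_divNat]
    rw [mul_comm, Nat.mul_add_div hd, Nat.div_eq_of_lt j.2, add_zero]
  have h2 : Fin.modNat ⟨q * d + j, h⟩ = j := by
    ext
    simp only [Fin.coe_modNat]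
    rw [mul_comm, Nat.mul_add_mod, Nat.mod_eq_of_lt j.2]
  simp [input, h, h1, h2]

theorem signedSum_input (ω : ℕ → Bool) (k : ℕ) (l : Fin k) (q : Fin n) :
    signedSum (fun j => (ω (l * d + j)).toNat) ((input ℓ ε p).real 1) d (q * d) =
      signSum (p q) (coinRows k d ω l) := by
  rw [signedSum, Finset.sum_range]
  refine Finset.sum_congr rfl fun j _ => ?_
  rw [input_real_one]
  cases h : ω (l * d + j) <;> simp [h, coinRows, sign]

/-- Projecting is linear: the difference of two signed sums with the same signs is the signed sum of
the differences. -/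
theorem sqDist_eq_projDist {ω : ℕ → Bool} {k : ℕ} {y : ℕ → ℝ}
    (hy : ∀ l < k, ∀ q < n, y (l * n + q) =
      signedSum (fun j => (ω (l * d + j)).toNat) ((input ℓ ε p).real 1) d (q * d))
    (a b : Fin n) : sqDist y n k a b = projDist p (coinRows k d ω) a b := by
  rw [sqDist, projDist, Finset.sum_range]
  refine Finset.sum_congr rfl fun l _ => ?_
  rw [add_comm, hy l l.2 a a.2, add_comm, hy l l.2 b b.2, signedSum_input, signedSum_input]
  simp only [signSum, ← Finset.sum_sub_distrib, sub_mul]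

end Input

theorem ends_clusterProg {n d ℓ : ℕ} {ε : ℝ} (p : Fin n → EuclideanSpace ℝ (Fin d)) (hℓ : 1 ≤ ℓ)
    (hn : ℓ < n) (hε : 0 < ε) (c : ℕ) (hc : 0 < c) (ω : ℕ → Bool) {k : ℕ}
    (hk : k = ⌈c * (Nat.clog 2 n : ℝ) / ε ^ 2⌉₊) :
    Ends ω (clusterProg c) (input ℓ ε p) (1000 * (k * n * (d + ℓ))) fun s' =>
      ∃ (σ : Fin ℓ → Fin n) (f : Fin n → Fin ℓ),
        IsFarthestPoint (projDist p (coinRows k d ω)) σ f ∧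
        outputPoints d ℓ s' = p ∘ σ ∧ OutputsClusters s' f := by
  set s := input ℓ ε p with hs
  have i0 : s.nat 0 0 = n := by simp [hs, input]
  have i1 : s.nat 0 1 = d := by simp [hs, input]
  have i2 : s.nat 0 2 = ℓ := by simp [hs, input]
  have iε : s.real 0 0 = ε := by simp [hs, input]
  have hlog : 0 < Nat.clog 2 n := Nat.clog_pos one_lt_two (by omega)
  have hlogn : Nat.clog 2 n ≤ n := Nat.clog_le_of_le_pow Nat.lt_two_pow_self.le
  have hk0 : 0 < k := by
    rw [hk]
    exact Nat.ceil_pos.2 (by positivity)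
  have hlogP := ends_logProg ω s
  rw [i0] at hlogP
  refine Ends.le (Ends.seq hlogP fun s₁ hf₁ h1 => Ends.seq (T := 30 * k + 30)
    (R := fun s' => s'.nat 3 0 = k) ?_ fun s₂ hf₂ h2 => Ends.seq
      (T := k * (n * (43 * d + 50) + 16 * d + 45) + 20) (R := fun s' =>
        ∀ l < k, ∀ q < n, s'.real 5 (l * n + q) =
          signedSum (fun j => (ω (l * d + j)).toNat) (s.real 1) d (q * d)) ?_
      fun s₃ hf₃ h3 => Ends.seq (T := ℓ * (n * (47 * k + 120) + 100) + 60) (R := fun s' =>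
        ∃ D, Greedy (sqDist (s₃.real 5) n k) n ℓ (s'.nat 12) (s'.nat 1) D) ?_
      fun s₄ hf₄ ⟨D, h4⟩ => Ends.mono (T := ℓ * (25 * n + 40 * d + 80) + 40) (Q := fun s' =>
        ∀ t < ℓ, ∀ j < d, s'.real 2 (t * d + j) = s.real 1 (s₄.nat 12 t * d + j)) ?_ le_rfl
      fun s₅ hf₅ h5 => ?_) ?_
  · have h := ends_dimProg ω s₁ c (by simpa (disch := decide) [hf₁.real, iε] using hε)
    simp (disch := decide) only [hf₁.real, iε, h1] at h
    rwa [← hk] at h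
  · have e2 : s₂.nat 0 = s.nat 0 := by
      rw [hf₂.nat (by simp [dimProg, Program.natWrites]), hf₁.nat (by decide)]
    have e2r : s₂.real 1 = s.real 1 := by
      rw [hf₂.real (by simp [dimProg, Program.realWrites]), hf₁.real (by decide)]
    have h := ends_projProg ω s₂ (by rw [hf₂.used rfl, hf₁.used rfl]; rfl)
    simpa only [e2, e2r, i0, i1, h2] using h
  · have e3 : s₃.nat 0 = s.nat 0 := by
      rw [hf₃.nat (by decide), hf₂.nat (by simp [dimProg, Program.natWrites]),
        hf₁.nat (by decide)]
    have h := ends_greedyProg ω s₃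
    simp only [e3, hf₃.nat (a := 3) (by decide), i0, i2, h2] at h
    exact h (by omega) hn
  · have e4 : s₄.nat 0 = s.nat 0 := by
      rw [hf₄.nat (by decide), hf₃.nat (by decide),
        hf₂.nat (by simp [dimProg, Program.natWrites]), hf₁.nat (by decide)]
    have e4r : s₄.real 1 = s.real 1 := by
      rw [hf₄.real (by decide), hf₃.real (by decide),
        hf₂.real (by simp [dimProg, Program.realWrites]), hf₁.real (by decide)]
    have h := ends_outProg ω s₄
    simp only [e4, e4r, i0, i1, i2] at h
    exact h h4.center_lt
  · have hd := sqDist_eq_projDist ℓ ε p h3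
    have h5n : s₅.nat 1 = s₄.nat 1 := hf₅.nat (by decide)
    let σ : Fin ℓ → Fin n := fun t => ⟨s₄.nat 12 t, h4.center_lt t t.2⟩
    let f : Fin n → Fin ℓ := fun q => ⟨s₄.nat 1 q, h4.cl_lt q q.2⟩
    refine ⟨σ, f, ⟨fun t => ?_, fun q t => ?_, fun q t u htu => ?_⟩, ?_, fun q => ?_⟩
    · ext
      exact (h4.center t t.2).1
    · rw [← hd, ← hd]
      exact h4.near q q.2 t t.2
    · rw [← hd, ← hd]
      exact h4.separated (sqDist_self _ _ _) (sqDist_nonneg _ _ _) q.2 t.2 u.2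
        fun e => htu (Fin.ext e)
    · ext t j
      have := input_real_one ℓ ε p (σ t) j
      simp only [outputPoints, Function.comp]
      rw [← this]
      exact h5 t t.2 j j.2
    · simp [h5n, f]
  -- Every term is absorbed by k n ℓ or k n d. Terms without d go to k n ℓ, since d may be zero
  -- whereas ℓ ≥ 1.
  · have hX : 1 ≤ n := by omega
    have a1 : n ≤ k * n * ℓ := by nlinarith [Nat.mul_le_mul hk0 hℓ]
    have a2 : k ≤ k * n * ℓ := by nlinarith [Nat.mul_le_mul hX hℓ]
    have a3 : k * n ≤ k * n * ℓ := Nat.le_mul_of_pos_right _ hℓ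
    have a4 : n * ℓ ≤ k * n * ℓ := by
      rw [mul_assoc]
      exact Nat.le_mul_of_pos_left _ hk0
    have a5 : ℓ ≤ n * ℓ := Nat.le_mul_of_pos_left _ hX
    have a6 : k * d ≤ k * n * d := by
      rw [mul_right_comm]
      exact Nat.le_mul_of_pos_right _ hX
    have a7 : ℓ * d ≤ n * d := Nat.mul_le_mul_right d hn.le
    have a8 : n * d ≤ k * n * d := by
      rw [mul_assoc]
      exact Nat.le_mul_of_pos_left _ hk0
    nlinarith

theorem log_le_clog (n : ℕ) : Real.log n ≤ Nat.clog 2 n := by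
  rcases Nat.eq_zero_or_pos n with rfl | hn
  · simp
  have h1 : (n : ℝ) ≤ 2 ^ Nat.clog 2 n := by exact_mod_cast Nat.le_pow_clog one_lt_two n
  have h2 := Real.log_le_log (by exact_mod_cast hn) h1
  rw [Real.log_pow] at h2
  have h3 : (0 : ℝ) ≤ Nat.clog 2 n := Nat.cast_nonneg _
  nlinarith [Real.log_two_lt_d9]

/-- From 2^(clog n - 1) < n and 2 ≤ n one gets clog n · log 2 ≤ 2 log n, and 2 / log 2 < 3. -/
theorem clog_le_log {n : ℕ} (hn : 2 ≤ n) : (Nat.clog 2 n : ℝ) ≤ 3 * Real.log n := by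
  have h0 : Nat.clog 2 n ≠ 0 := (Nat.clog_pos one_lt_two hn).ne'
  have h1 : 2 ^ (Nat.clog 2 n - 1) < n := Nat.pow_pred_clog_lt_self one_lt_two (by omega)
  have h2 : (2 : ℝ) ^ (Nat.clog 2 n - 1) ≤ n := by exact_mod_cast h1.le
  have h3 := Real.log_le_log (by positivity) h2
  rw [Real.log_pow, Nat.cast_sub (by omega)] at h3
  have h4 : Real.log 2 ≤ Real.log n := Real.log_le_log (by norm_num) (by exact_mod_cast hn)
  have h5 := Real.log_two_gt_d9
  push_cast at h3
  have h6 : (1 : ℝ) ≤ Nat.clog 2 n := by exact_mod_cast Nat.one_le_iff_ne_zero.2 h0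
  nlinarith

theorem time_bound {n d ℓ : ℕ} {ε : ℝ} (hn : 2 ≤ n) (hε : 0 < ε) (hε' : ε < 1 / 2) (c : ℕ) :
    ((1000 * (⌈c * (Nat.clog 2 n : ℝ) / ε ^ 2⌉₊ * n * (d + ℓ)) : ℕ) : ℝ) ≤
      3000 * (c + 1) * (n * Real.log n * (d + ℓ) / ε ^ 2) := by
  have h1 := (Nat.ceil_lt_add_one (a := c * (Nat.clog 2 n : ℝ) / ε ^ 2) (by positivity)).le
  have h2 := clog_le_log hn
  -- This absorbs the +1 from rounding up, as ε² < 1 ≤ clog n; hence the factor c + 1.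
  have h3 : (1 : ℝ) ≤ Nat.clog 2 n := by exact_mod_cast Nat.clog_pos one_lt_two hn
  have h4 : (⌈c * (Nat.clog 2 n : ℝ) / ε ^ 2⌉₊ : ℝ) ≤ (c + 1) * (3 * Real.log n) / ε ^ 2 := by
    refine h1.trans ?_
    rw [← sub_nonneg]
    have : (c + 1) * (3 * Real.log n) / ε ^ 2 - (c * (Nat.clog 2 n : ℝ) / ε ^ 2 + 1) =
        ((c + 1) * (3 * Real.log n) - c * Nat.clog 2 n - ε ^ 2) / ε ^ 2 := by
      field_simp
      ring
    rw [this]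
    refine div_nonneg ?_ (by positivity)
    have hc : (0 : ℝ) ≤ c := Nat.cast_nonneg _
    nlinarith [mul_le_mul_of_nonneg_left h2 hc]
  push_cast
  calc (1000 : ℝ) * (⌈c * (Nat.clog 2 n : ℝ) / ε ^ 2⌉₊ * n * (d + ℓ)) ≤
      1000 * ((c + 1) * (3 * Real.log n) / ε ^ 2 * n * (d + ℓ)) := by gcongr
    _ = _ := by ring

theorem failure_bound {n : ℕ} {β ε : ℝ} (hn : 2 ≤ n) (hε : 0 < ε) {k : ℕ}
    (hk : k = ⌈(192 * ⌈β + 3⌉₊ : ℕ) * (Nat.clog 2 n : ℝ) / ε ^ 2⌉₊) :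
    n ^ 2 * (2 * Real.exp (-(k * (ε / 4) ^ 2 / 12))) ≤ (n : ℝ) ^ (-β) := by
  have hn' : (2 : ℝ) ≤ n := by exact_mod_cast hn
  have h1 := Nat.le_ceil ((192 * ⌈β + 3⌉₊ : ℕ) * (Nat.clog 2 n : ℝ) / ε ^ 2)
  rw [← hk, div_le_iff₀ (by positivity)] at h1
  have h2 := log_le_clog n
  have h3 := Nat.le_ceil (β + 3)
  have h4 : 0 ≤ Real.log n := Real.log_nonneg (by linarith)
  push_cast at h1
  -- The factor 192 = 12 · 4² cancels the 12 of the tail bound and the square of ε/4. Of the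
  -- exponent β + 3, two units pay for the n² pairs and one for the factor 2 ≤ n.
  have h5 : (β + 3) * Real.log n ≤ k * (ε / 4) ^ 2 / 12 := by
    have := mul_le_mul h3 h2 h4 (Nat.cast_nonneg _)
    nlinarith
  calc (n : ℝ) ^ 2 * (2 * Real.exp (-(k * (ε / 4) ^ 2 / 12))) ≤
      n ^ 2 * (n * Real.exp (-((β + 3) * Real.log n))) := by gcongr
    _ = (n : ℝ) ^ (3 : ℝ) * (n : ℝ) ^ (-(β + 3)) := by
        rw [Real.rpow_def_of_pos (by linarith) (-(β + 3)), show (3 : ℝ) = (3 : ℕ) by norm_num,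
          Real.rpow_natCast, mul_comm (Real.log n), neg_mul, pow_succ]
        push_cast
        ring
    _ = (n : ℝ) ^ (-β) := by
        rw [← Real.rpow_add (by linarith)]
        congr 1
        ring

end RealRAM

theorem mainTheorem1 (β : ℝ) (hβ : 1 ≤ β) :
    (∃ (A : RealRAM.Program) (C : ℝ),
      ∀ (n d ℓ : ℕ) (ε : ℝ) (p : Fin n → EuclideanSpace ℝ (Fin d)),
        1 ≤ ℓ → ℓ < n → 0 < ε → ε < 1 / 2 →
        (∀ ω : ℕ → Bool, ∃ (s : RealRAM.State) (t : ℕ),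
          RealRAM.Exec ω A (RealRAM.input ℓ ε p) s t ∧
          (t : ℝ) ≤ C * (n * Real.log n * (d + ℓ) / ε ^ 2) ∧
          ∃ σ : Fin ℓ → Fin n, Function.Injective σ ∧
            RealRAM.outputPoints d ℓ s = p ∘ σ) ∧
        1 - (n : ℝ) ^ (-β) ≤ RealRAM.coins.real
          {ω | ∃ (s : RealRAM.State) (t : ℕ),
            RealRAM.Exec ω A (RealRAM.input ℓ ε p) s t ∧
            Clustering.radius p (RealRAM.outputPoints d ℓ s) ≤
              (2 + ε) * Clustering.optRadius ℓ p}) ∧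
    (∃ (A : RealRAM.Program) (C : ℝ),
      ∀ (n d ℓ : ℕ) (ε : ℝ) (p : Fin n → EuclideanSpace ℝ (Fin d)),
        1 ≤ ℓ → ℓ < n → 0 < ε → ε < 1 / 2 →
        (∀ ω : ℕ → Bool, ∃ (s : RealRAM.State) (t : ℕ),
          RealRAM.Exec ω A (RealRAM.input ℓ ε p) s t ∧
          (t : ℝ) ≤ C * (n * Real.log n * (d + ℓ) / ε ^ 2) ∧
          ∃ c : Fin n → Fin ℓ, Function.Surjective c ∧ RealRAM.OutputsClusters s c) ∧
        1 - (n : ℝ) ^ (-β) ≤ RealRAM.coins.real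
          {ω | ∃ (s : RealRAM.State) (t : ℕ) (c : Fin n → Fin ℓ),
            RealRAM.Exec ω A (RealRAM.input ℓ ε p) s t ∧
            RealRAM.OutputsClusters s c ∧
            Clustering.maxDiam p c ≤ (2 + ε) * Clustering.optDiam ℓ p}) := by
  have hc : 0 < 192 * ⌈β + 3⌉₊ := by
    have : 0 < ⌈β + 3⌉₊ := Nat.ceil_pos.2 (by linarith)
    omega
  constructor
  all_goals
    refine ⟨RealRAM.clusterProg (192 * ⌈β + 3⌉₊),
      3000 * ((192 * ⌈β + 3⌉₊ : ℕ) + 1), fun n d ℓ ε p hℓ hn h0 h1 => ?_⟩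
    obtain ⟨k, hk⟩ : ∃ k, k = ⌈(192 * ⌈β + 3⌉₊ : ℕ) * (Nat.clog 2 n : ℝ) / ε ^ 2⌉₊ := ⟨_, rfl⟩
    have hrun := fun ω => RealRAM.ends_clusterProg p hℓ hn h0 _ hc ω hk
    have hk0 : 0 < k := by
      have := Nat.clog_pos one_lt_two (show 2 ≤ n by omega)
      rw [hk]
      exact Nat.ceil_pos.2 (by positivity)
    have htime := RealRAM.time_bound (n := n) (d := d) (ℓ := ℓ) (by omega) h0 h1
      (192 * ⌈β + 3⌉₊)
    rw [← hk] at htime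
    have hprob := JL.one_sub_le_coins_preserves k p (δ := ε / 4) (by linarith) (by linarith)
    have hfail := RealRAM.failure_bound (β := β) (show 2 ≤ n by omega) h0 hk
    -- Success is only shown to contain the event that all distances are preserved; monotonicity
    -- does not require the success event to be measurable.
    refine ⟨fun ω => ?_, (sub_le_sub_left hfail 1).trans (hprob.trans
      (MeasureTheory.measureReal_mono (fun ω hω => ?_) (MeasureTheory.measure_ne_top _ _)))⟩
  · obtain ⟨s, t, he, ht, σ, f, hF, hout, -⟩ := hrun ω
    -- The assignment is a left inverse of `σ`, so the chosen indices are distinct for all coins,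
    -- even if points coincide.
    exact ⟨s, t, he, le_trans (by exact_mod_cast ht) htime, σ,
      Function.LeftInverse.injective hF.assign_center, hout⟩
  · obtain ⟨s, t, he, -, σ, f, hF, hout, -⟩ := hrun ω
    refine ⟨s, t, he, ?_⟩
    rw [hout]
    exact Clustering.radius_le_of_farthestPoint h0 h1 hk0 hℓ hn hω hF
  · obtain ⟨s, t, he, ht, σ, f, hF, -, hcl⟩ := hrun ω
    exact ⟨s, t, he, le_trans (by exact_mod_cast ht) htime, f,
      fun a => ⟨σ a, hF.assign_center a⟩, hcl⟩
  · obtain ⟨s, t, he, -, σ, f, hF, -, hcl⟩ := hrun ω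
    exact ⟨s, t, f, he, hcl, Clustering.maxDiam_le_of_farthestPoint h0 h1 hk0 hℓ hω hF⟩
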